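/- Let $M$ be a unital $C^*$-algebra, let $M^*_+$ be the set of positive linear forms on $M$, and let $\nu,\varrho\in M^*_+$. For a unital $*$-representation $\pi$ of $M$ on a Hilbert space $\mathcal K$ (inner product linear in the first argument) and $\mu\in M^*_+$ let $$\mathcal S_{\pi,M}(\mu)=\{\chi\in\mathcal K:\ \mu(x)=\langle\pi(x)\chi,\chi\rangle\ \text{for all }x\in M\}$$ be the $\pi$-fibre of $\mu$, and let $$d_B(\nu,\varrho)=\inf\{\|\psi-\varphi\|:\ \varphi\in\mathcal S_{\pi,M}(\nu),\ \psi\in\mathcal S_{\pi,M}(\varrho)\},$$ the infimum being taken over all unital $*$-representations $\pi$ for which both fibres are non-empty and over all such $\varphi,\psi$. Let $\varrho^\perp$ be the largest element of the set of all $\sigma\in M^*_+$ with $\sigma\le\varrho$ and $\sigma\perp\nu$, where $\sigma\perp\nu$ means $\|\sigma-\nu\|=\|\sigma\|+\|\nu\|$. Fix a unital $*$-representation $\pi$ of $M$ on $\mathcal K$ for which the $\pi$-fibres of $\nu$ and $\varrho$ are both non-empty. Let $\pi(M)'$ be the commutant of $\pi(M)$. For $\chi\in\mathcal K$ let $p'_\pi(\chi)$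 be the orthogonal projection onto $\overline{\pi(M)\chi}$. For $\psi,\varphi\in\mathcal K$ let $h_{\psi,\varphi}$ be the normal linear form $h_{\psi,\varphi}(z)=\langle z\psi,\varphi\rangle$ on $\pi(M)'$, with polar decomposition $h_{\psi,\varphi}=|h_{\psi,\varphi}|\bigl((\cdot)\,v_{\psi,\varphi}\bigr)$; here $|h_{\psi,\varphi}|$ is a normal positive linear form on $\pi(M)'$ and $v_{\psi,\varphi}\in\pi(M)'$ is a partial isometry, and both are uniquely determined by the condition that $v_{\psi,\varphi}^*v_{\psi,\varphi}$ is the support projection $s(|h_{\psi,\varphi}|)$. Write $s^\perp=\mathbf 1-s$. Finally, let $\mathcal S_{\pi,M}(\nu|\varrho)$ be the set of all $\varphi\in\mathcal S_{\pi,M}(\nu)$ for which there is a $\psi\in\mathcal S_{\pi,M}(\varrho)$ with $d_B(\nu,\varrho)=\|\psi-\varphi\|$. **Theorem.** Let $\varphi_0\in\mathcal S_{\pi,M}(\nu)$. 1. $\varphi_0\in\mathcal S_{\pi,M}(\nu|\varrho)$ if and only if there are $\eta\in\mathcal S_{\pi,M}(\varrho^\perp)$ and $\psi\in\mathcal S_{\pi,M}(\varrho)$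 with $$p'_\pi(\eta)\le s(|h_{\psi,\varphi_0}|)^\perp.\qquad(*)$$ 2. Whenever $\eta\in\mathcal S_{\pi,M}(\varrho^\perp)$ and $\psi\in\mathcal S_{\pi,M}(\varrho)$ satisfy $(*)$, the vector $\psi_0=v_{\psi,\varphi_0}^*\psi+\eta$ belongs to $\mathcal S_{\pi,M}(\varrho)$ and satisfies $d_B(\nu,\varrho)=\|\psi_0-\varphi_0\|$. Moreover, for the same $\varphi_0$ and $\eta$, condition $(*)$ then holds with $\psi$ replaced by any $\psi'\in\mathcal S_{\pi,M}(\varrho)$, and $v_{\psi',\varphi_0}^*\psi'+\eta=\psi_0$ for each such $\psi'$. -/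

import Mathlib

open scoped ComplexOrder

universe u v

noncomputable section

namespace BuresFibre

section Forms

variable {M : Type u} [CStarAlgebra M]

/-- A bounded linear form on a unital C*-algebra is positive if it is nonnegative on the
positive elements, that is, on the elements `x* x`. -/
def IsPositiveForm (f : M →L[ℂ] ℂ) : Prop :=
  ∀ x : M, 0 ≤ f (star x * x)

/-- The order of linear forms: `f ≤ g` if and only if `g - f` is positive. -/
def FormLE (f g : M →L[ℂ] ℂ) : Prop :=
  IsPositiveForm (g - f)

/-- Orthogonality of positive linear forms: `‖f - g‖ = ‖f‖ + ‖g‖` in the functional norm. -/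
def Orthogonal (f g : M →L[ℂ] ℂ) : Prop :=
  ‖f - g‖ = ‖f‖ + ‖g‖

/-- `σ` is the largest positive linear form which is below `ϱ` and orthogonal to `ν`. -/
def IsLargestOrthogonalBelow (ν ϱ σ : M →L[ℂ] ℂ) : Prop :=
  (IsPositiveForm σ ∧ Orthogonal σ ν ∧ FormLE σ ϱ) ∧
    ∀ τ : M →L[ℂ] ℂ, IsPositiveForm τ → Orthogonal τ ν → FormLE τ ϱ → FormLE τ σ

open Classical in
/-- The form `ϱ^⊥` of the pair `{ν, ϱ}`: the largest positive linear form which is below `ϱ` and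
orthogonal to `ν`. It exists and is unique for positive `ν`, `ϱ`. -/
def perpPart (ν ϱ : M →L[ℂ] ℂ) : M →L[ℂ] ℂ :=
  if h : ∃ σ, IsLargestOrthogonalBelow ν ϱ σ then h.choose else 0

end Forms

section Fibres

variable {M : Type u} [CStarAlgebra M]
variable {H : Type v} [NormedAddCommGroup H] [InnerProductSpace ℂ H] [CompleteSpace H]

/-- The `π`-fibre of `μ`: all vectors `χ` with `μ(x) = ⟨π(x)χ, χ⟩` for all `x`. (Mathlib's inner
product is linear in the second argument.) -/
def fibre (π : M →⋆ₐ[ℂ] (H →L[ℂ] H)) (μ : M →L[ℂ] ℂ) : Set H :=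
  {χ | ∀ x : M, μ x = inner ℂ χ (π x χ)}

/-- The set of all numbers `‖ψ - φ‖`, with `φ`, `ψ` in the fibres of `ν`, `ϱ` relative to one and
the same unital *-representation. The Hilbert spaces range over a universe that is at least as
large as that of `M`, so that it contains the GNS representation of `ν + ϱ`. -/
def fibreDistances (ν ϱ : M →L[ℂ] ℂ) : Set ℝ :=
  {r | ∃ (K : Type (max u v)) (_ : NormedAddCommGroup K) (_ : InnerProductSpace ℂ K)
      (_ : CompleteSpace K) (π : M →⋆ₐ[ℂ] (K →L[ℂ] K)),
      ∃ φ ∈ fibre π ν, ∃ ψ ∈ fibre π ϱ, r = ‖ψ - φ‖}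

/-- The Bures distance `d_B(M | ν, ϱ)`. -/
def buresDist (ν ϱ : M →L[ℂ] ℂ) : ℝ :=
  sInf (fibreDistances.{u, v} ν ϱ)

/-- The set of all `φ` in the `π`-fibre of `ν` such that the Bures distance of `ν` and `ϱ` is
attained at `φ` and some vector in the `π`-fibre of `ϱ`. -/
def attainingFibre (π : M →⋆ₐ[ℂ] (H →L[ℂ] H)) (ν ϱ : M →L[ℂ] ℂ) : Set H :=
  {φ | φ ∈ fibre π ν ∧ ∃ ψ ∈ fibre π ϱ, buresDist.{u, v} ν ϱ = ‖ψ - φ‖}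

/-- The commutant `π(M)'`. -/
def commutant (π : M →⋆ₐ[ℂ] (H →L[ℂ] H)) : StarSubalgebra ℂ (H →L[ℂ] H) :=
  StarSubalgebra.centralizer ℂ (Set.range π)

theorem mem_commutant_iff (π : M →⋆ₐ[ℂ] (H →L[ℂ] H)) (z : H →L[ℂ] H) :
    z ∈ commutant π ↔ ∀ x : M, z * π x = π x * z := by
  rw [commutant, StarSubalgebra.mem_centralizer_iff]
  constructor
  · intro h x
    exact (h (π x) ⟨x, rfl⟩).1.symm
  · rintro h _ ⟨x, rfl⟩
    refine ⟨(h x).symm, ?_⟩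
    rw [← map_star]
    exact (h (star x)).symm

/-- `p'_π(χ)`: the orthoprojection onto the closure of `π(M)χ`. -/
def cyclicProj (π : M →⋆ₐ[ℂ] (H →L[ℂ] H)) (χ : H) : H →L[ℂ] H :=
  (Submodule.span ℂ (Set.range fun x : M => π x χ)).topologicalClosure.starProjection

end Fibres

section Polar

variable {H : Type v} [NormedAddCommGroup H] [InnerProductSpace ℂ H] [CompleteSpace H]

/-- A linear form on a von Neumann algebra `N` acting on `H` is normal (ultraweakly continuous) if
it has the form `z ↦ ∑ₙ ⟨z xₙ, yₙ⟩` with `∑ₙ ‖xₙ‖² < ∞` and `∑ₙ ‖yₙ‖² < ∞`. -/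
def IsNormalForm (N : StarSubalgebra ℂ (H →L[ℂ] H)) (f : N →ₗ[ℂ] ℂ) : Prop :=
  ∃ x y : ℕ → H, Summable (fun n => ‖x n‖ ^ 2) ∧ Summable (fun n => ‖y n‖ ^ 2) ∧
    ∀ z : N, HasSum (fun n => inner ℂ (y n) ((z : H →L[ℂ] H) (x n))) (f z)

/-- The support orthoprojection `s(g)` of a normal positive linear form `g` on a von Neumann
algebra `N`: the least orthoprojection `p` in `N` with `g(1 - p) = 0`, given as the
orthoprojection onto the intersection of the ranges of all such `p`. -/
def support (N : StarSubalgebra ℂ (H →L[ℂ] H)) (g : N →ₗ[ℂ] ℂ) : H →L[ℂ] H :=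
  (⨅ p : {p : N // IsStarProjection p ∧ g (1 - p) = 0},
    ((p : N) : H →L[ℂ] H).range).topologicalClosure.starProjection

/-- `h = g((·)v)` is the polar decomposition of the linear form `h` on the von Neumann algebra `N`:
`g` is a normal positive linear form on `N` and `v ∈ N` has `v* v = s(g)` (so that `v` is a partial
isometry). -/
structure IsPolarDecomposition (N : StarSubalgebra ℂ (H →L[ℂ] H)) (h g : N →ₗ[ℂ] ℂ) (v : N) :
    Prop where
  normal : IsNormalForm N g
  nonneg : ∀ z : N, 0 ≤ g (star z * z)
  initial : ((star v * v : N) : H →L[ℂ] H) = support N g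
  factor : ∀ z : N, h z = g (z * v)

open Classical in
/-- The pair `(|h|, v)` of the polar decomposition of `h`. It exists and is unique for every normal
linear form on a von Neumann algebra. -/
def polarPair (N : StarSubalgebra ℂ (H →L[ℂ] H)) (h : N →ₗ[ℂ] ℂ) : (N →ₗ[ℂ] ℂ) × N :=
  if hp : ∃ q : (N →ₗ[ℂ] ℂ) × N, IsPolarDecomposition N h q.1 q.2 then hp.choose else 0

/-- The absolute value `|h|` of a normal linear form. -/
def absForm (N : StarSubalgebra ℂ (H →L[ℂ] H)) (h : N →ₗ[ℂ] ℂ) : N →ₗ[ℂ] ℂ :=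
  (polarPair N h).1

/-- The partial isometry of the polar decomposition of a normal linear form. -/
def phase (N : StarSubalgebra ℂ (H →L[ℂ] H)) (h : N →ₗ[ℂ] ℂ) : H →L[ℂ] H :=
  ((polarPair N h).2 : H →L[ℂ] H)

end Polar

section Forms2

variable {M : Type u} [CStarAlgebra M]
variable {H : Type v} [NormedAddCommGroup H] [InnerProductSpace ℂ H] [CompleteSpace H]

/-- The linear form `h_{ψ,φ}(z) = ⟨zψ, φ⟩` on the commutant `π(M)'`. -/
def transitionForm (π : M →⋆ₐ[ℂ] (H →L[ℂ] H)) (ψ φ : H) : commutant π →ₗ[ℂ] ℂ where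
  toFun z := inner ℂ φ ((z : H →L[ℂ] H) ψ)
  map_add' z w := by simp
  map_smul' c z := by simp

/-- `s(|h_{ψ,φ}|)`. -/
def absSupport (π : M →⋆ₐ[ℂ] (H →L[ℂ] H)) (ψ φ : H) : H →L[ℂ] H :=
  support (commutant π) (absForm (commutant π) (transitionForm π ψ φ))

/-- The partial isometry `v_{ψ,φ}` of the polar decomposition of `h_{ψ,φ}`. -/
def transitionPhase (π : M →⋆ₐ[ℂ] (H →L[ℂ] H)) (ψ φ : H) : H →L[ℂ] H :=
  phase (commutant π) (transitionForm π ψ φ)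

end Forms2

end BuresFibre

end

/-! Take `ψ` in the fibre of `ϱ`, put `h = h_{ψ,φ₀}`, `g = |h|`, let `v` be the phase and `s = v*v =
s(g)`. Everything rests on two computations in terms of this polar decomposition.

Distance. Vectors of the two fibres in any other representation are images of `φ₀` and `ψ` under
intertwining contractions `U`, `W`, so their inner product is `h(U*W)` with `U*W` a contraction in
the commutant. Hence its real part is at most `g(1)`. In the direct sum of two copies of `π` the
bound is attained by `(φ₀, 0)` and `(v*ψ, (1 - vv*)ψ)`. Thus `d_B² = ‖ψ‖² + ‖φ₀‖² - 2g(1)`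
(`buresDist_sq`), and a vector `χ` of the fibre of `ϱ` attains the distance at `φ₀` exactly when the
real part of its inner product with `φ₀` is `g(1)`.

Orthogonal part. Vector forms of `χ` and `φ` are orthogonal if and only if `⟨zχ, φ⟩ = 0` for all `z`
in the commutant (`inner_intertwiner_eq_zero`, `orthogonal_vectorForm`). It follows that `ϱ^⊥` is
the vector form of `(1 - vv*)ψ` (`isLargestOrthogonalBelow`, `perpPart_eq`).

Condition `(*)` says `sη = 0`. Since `v*ψ` lies in the range of `s`, the orbits of `v*ψ` and `η` are
then orthogonal, their vector forms add up to `ϱ`, and `η` contributes nothing to the inner product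
with `φ₀`; so `v*ψ + η` attains the distance. Conversely, if `ψ` itself attains it, then `Re g(v) =
g(1)`, which forces `v = s`, and `η = (1 - s)ψ` satisfies `(*)`. Finally, any other `ψ'` is `wψ`
with `w` in the commutant and `w*wψ = ψ`. The polar decomposition of `h_{ψ',φ₀}` is then `(g, wv)`,
so neither `s` nor `v*ψ` changes. -/

noncomputable section

namespace BuresFibre

/-! ### Positive functionals on *-algebras -/

section PositiveFunctional

variable {A : Type*} [Ring A] [StarRing A] [Algebra ℂ A] [StarModule ℂ A]

/-- A positive functional is hermitian with respect to its sesquilinear form. -/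
theorem positive_conj_symm (g : A →ₗ[ℂ] ℂ) (hg : ∀ z, 0 ≤ g (star z * z)) (a b : A) :
    (starRingEnd ℂ) (g (star b * a)) = g (star a * b) := by
  -- Polarization: reality of `g` at `a + b` and at `a + ib` gives the imaginary and the real part
  -- of the identity.
  have h0 : ∀ z, (g (star z * z)).im = 0 := fun z => (Complex.nonneg_iff.1 (hg z)).2.symm
  have h1 := h0 (a + b)
  have h2 := h0 (a + Complex.I • b)
  simp only [star_add, star_smul, add_mul, mul_add, smul_mul_assoc, mul_smul_comm, map_add,
    map_smul, smul_eq_mul, Complex.add_im, Complex.mul_im, Complex.I_re, Complex.I_im,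
    RCLike.star_def, Complex.conj_I, Complex.neg_re, Complex.neg_im, Complex.mul_re, h0] at h1 h2
  apply Complex.ext
  · simp only [Complex.conj_re]
    linarith
  · simp only [Complex.conj_im]
    linarith

/-- The semi-inner product of a positive functional. -/
abbrev positiveCore (g : A →ₗ[ℂ] ℂ) (hg : ∀ z, 0 ≤ g (star z * z)) :
    PreInnerProductSpace.Core ℂ A where
  inner a b := g (star a * b)
  conj_inner_symm a b := positive_conj_symm g hg a b
  re_inner_nonneg a := (Complex.nonneg_iff.1 (hg a)).1
  add_left a b c := by simp [add_mul]
  smul_left a b r := by simp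

theorem positive_cauchy_schwarz (g : A →ₗ[ℂ] ℂ) (hg : ∀ z, 0 ≤ g (star z * z)) (a b : A) :
    ‖g (star a * b)‖ * ‖g (star a * b)‖ ≤ (g (star a * a)).re * (g (star b * b)).re := by
  let _ := positiveCore g hg
  have h := InnerProductSpace.Core.inner_mul_inner_self_le (𝕜 := ℂ) a b
  have h2 : ‖g (star b * a)‖ = ‖g (star a * b)‖ := by
    rw [← positive_conj_symm g hg a b, RCLike.norm_conj]
  change ‖g (star a * b)‖ * ‖g (star b * a)‖ ≤ _ at h
  rwa [h2] at h

theorem positive_mul_eq_zero (g : A →ₗ[ℂ] ℂ) (hg : ∀ z, 0 ≤ g (star z * z)) {z : A}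
    (hz : g (star z * z) = 0) (a : A) : g (a * z) = 0 := by
  have h := positive_cauchy_schwarz g hg (star a) z
  rw [hz, star_star, Complex.zero_re, mul_zero] at h
  exact norm_eq_zero.1 (mul_self_eq_zero.1 (le_antisymm h (mul_self_nonneg _)))

theorem positive_map_star (g : A →ₗ[ℂ] ℂ) (hg : ∀ z, 0 ≤ g (star z * z)) (a : A) :
    g (star a) = (starRingEnd ℂ) (g a) := by
  simpa using (positive_conj_symm g hg a 1).symm

/-- Two positive functionals agree if they agree on the elements `x* x`. -/
theorem functional_ext_of_star_mul_self {f g : A →ₗ[ℂ] ℂ}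
    (h : ∀ x, f (star x * x) = g (star x * x)) : f = g := by
  have hp : ∀ z, 0 ≤ (f - g) (star z * z) := fun z => by simp [h z]
  ext a
  have := positive_mul_eq_zero (f - g) hp (z := (1 : A)) (by simpa using sub_eq_zero.2 (h 1)) a
  rw [mul_one] at this
  exact sub_eq_zero.1 this

end PositiveFunctional

/-! ### Intertwiners, fibres and vector forms -/

section Intertwiner

variable {M : Type u} [CStarAlgebra M]
variable {H : Type*} [NormedAddCommGroup H] [InnerProductSpace ℂ H] [CompleteSpace H]
variable {K : Type*} [NormedAddCommGroup K] [InnerProductSpace ℂ K] [CompleteSpace K]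

/-- The orbit map `x ↦ π(x)χ` as a linear map. -/
def orbit (π : M →⋆ₐ[ℂ] (H →L[ℂ] H)) (χ : H) : M →ₗ[ℂ] H where
  toFun x := π x χ
  map_add' x y := by simp
  map_smul' c x := by simp

@[simp] theorem orbit_apply (π : M →⋆ₐ[ℂ] (H →L[ℂ] H)) (χ : H) (x : M) :
    orbit π χ x = π x χ := rfl

theorem inner_rep_left (π : M →⋆ₐ[ℂ] (H →L[ℂ] H)) (x : M) (ξ η : H) :
    inner ℂ (π x ξ) η = inner ℂ ξ (π (star x) η) := by
  rw [map_star, ContinuousLinearMap.star_eq_adjoint, ContinuousLinearMap.adjoint_inner_right]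

/-- The orthogonal complement of an invariant set is invariant. -/
theorem rep_mem_orthogonal (π : M →⋆ₐ[ℂ] (H →L[ℂ] H)) (V : Submodule ℂ H)
    (hV : ∀ x, ∀ ξ ∈ V, π x ξ ∈ V) (x : M) {ξ : H} (hξ : ξ ∈ Vᗮ) : π x ξ ∈ Vᗮ := by
  rw [Submodule.mem_orthogonal] at hξ ⊢
  intro u hu
  rw [← star_star x, ← inner_rep_left]
  exact hξ _ (hV _ _ hu)

/-- The orthoprojection onto an invariant closed subspace commutes with the representation. -/
theorem rep_starProjection (π : M →⋆ₐ[ℂ] (H →L[ℂ] H)) (V : Submodule ℂ H)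
    [V.HasOrthogonalProjection] (hV : ∀ x, ∀ ξ ∈ V, π x ξ ∈ V) (x : M) (ξ : H) :
    V.starProjection (π x ξ) = π x (V.starProjection ξ) := by
  refine Submodule.eq_starProjection_of_mem_orthogonal (hV _ _ (V.starProjection_apply_mem ξ)) ?_
  rw [← map_sub]
  exact rep_mem_orthogonal π V hV x (V.sub_starProjection_mem_orthogonal ξ)

theorem rep_mem_closure (π : M →⋆ₐ[ℂ] (H →L[ℂ] H)) (V : Submodule ℂ H)
    (hV : ∀ x, ∀ ξ ∈ V, π x ξ ∈ V) (x : M) (ξ : H) (hξ : ξ ∈ V.topologicalClosure) :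
    π x ξ ∈ V.topologicalClosure := by
  have h : (V.topologicalClosure : Set H) ⊆ (π x) ⁻¹' (V.topologicalClosure : Set H) := by
    rw [Submodule.topologicalClosure_coe]
    refine closure_minimal (fun η hη => subset_closure (hV x η hη)) ?_
    exact isClosed_closure.preimage (π x).continuous
  exact h hξ

theorem rep_mem_range_orbit (π : M →⋆ₐ[ℂ] (H →L[ℂ] H)) (χ : H) (x : M) (ξ : H)
    (hξ : ξ ∈ LinearMap.range (orbit π χ)) : π x ξ ∈ LinearMap.range (orbit π χ) := by
  obtain ⟨y, rfl⟩ := hξ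
  exact ⟨x * y, by simp⟩

/-- If `‖π₂(x)χ₂‖ ≤ ‖π₁(x)χ₁‖` for all `x`, then some contraction intertwines the
representations and maps `χ₁` to `χ₂`. -/
theorem exists_intertwiner (π₁ : M →⋆ₐ[ℂ] (H →L[ℂ] H)) (π₂ : M →⋆ₐ[ℂ] (K →L[ℂ] K)) (χ₁ : H)
    (χ₂ : K) (h : ∀ x, ‖π₂ x χ₂‖ ≤ ‖π₁ x χ₁‖) :
    ∃ A : H →L[ℂ] K, ‖A‖ ≤ 1 ∧ A χ₁ = χ₂ ∧ ∀ x ξ, A (π₁ x ξ) = π₂ x (A ξ) := by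
  set V := (LinearMap.range (orbit π₁ χ₁)).topologicalClosure with hVdef
  have hV := rep_mem_closure π₁ _ (rep_mem_range_orbit π₁ χ₁)
  have hle : LinearMap.range (orbit π₁ χ₁) ≤ V := Submodule.le_topologicalClosure _
  let e : M →ₗ[ℂ] V := (orbit π₁ χ₁).codRestrict V fun x => hle ⟨x, rfl⟩
  have he : DenseRange e := by
    rw [DenseRange, Subtype.dense_iff]
    intro ξ hξ
    have : (Subtype.val '' Set.range e) = (LinearMap.range (orbit π₁ χ₁) : Set H) := by
      ext η
      simp [e, LinearMap.codRestrict]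
    refine closure_mono this.ge ?_
    exact hξ
  let B : V →L[ℂ] K := (orbit π₂ χ₂).extendOfNorm e
  have hB : ∀ x, B (e x) = π₂ x χ₂ := fun x =>
    LinearMap.extendOfNorm_eq he ⟨1, fun x => (h x).trans (one_mul ‖e x‖).ge⟩ x
  have hBn : ∀ ξ, ‖B ξ‖ ≤ ‖ξ‖ := fun ξ => by
    simpa using LinearMap.norm_extendOfNorm_apply_le he 1 (fun x => (h x).trans (one_mul ‖e x‖).ge) ξ
  have hBi : ∀ x (ξ : V), B ⟨π₁ x ξ, hV x ξ ξ.2⟩ = π₂ x (B ξ) := by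
    intro x ξ
    refine he.induction_on (p := fun ξ : V => B ⟨π₁ x ξ, hV x ξ ξ.2⟩ = π₂ x (B ξ)) ξ ?_ ?_
    · apply isClosed_eq
      · exact B.continuous.comp (Continuous.subtype_mk (by fun_prop) _)
      · fun_prop
    · intro y
      rw [hB, ← mul_apply_eq_comp, ← map_mul, ← hB]
      congr 1
      ext
      simp [e]
  -- Extension by zero on `Vᗮ`. It still intertwines because `V` is invariant under a
  -- *-representation, hence reducing.
  refine ⟨B ∘L V.orthogonalProjectionOnto, ?_, ?_, ?_⟩
  · refine ContinuousLinearMap.opNorm_le_bound _ zero_le_one fun ξ => ?_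
    rw [one_mul]
    exact (hBn _).trans (V.norm_orthogonalProjectionOnto_apply_le ξ)
  · have h1 : e 1 = ⟨χ₁, hle ⟨1, by simp⟩⟩ := by ext; simp [e]
    have h2 : V.orthogonalProjectionOnto χ₁ = e 1 := by
      rw [h1]
      exact Submodule.orthogonalProjectionOnto_mem_subspace_eq_self (K := V) ⟨χ₁, _⟩
    rw [ContinuousLinearMap.comp_apply, h2, hB]
    simp
  · intro x ξ
    rw [ContinuousLinearMap.comp_apply, ContinuousLinearMap.comp_apply, ← hBi]
    congr 1
    ext
    exact rep_starProjection π₁ V hV x ξ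

/-- By polarization a fibre is determined by the norms `‖π(x)χ‖` alone. All later comparisons of
forms become comparisons of orbit norms. -/
theorem mem_fibre_iff (π : M →⋆ₐ[ℂ] (H →L[ℂ] H)) (μ : M →L[ℂ] ℂ) (χ : H) :
    χ ∈ fibre π μ ↔ ∀ x, μ (star x * x) = (‖π x χ‖ : ℂ) ^ 2 := by
  have key : ∀ x, inner ℂ χ (π (star x * x) χ) = (‖π x χ‖ : ℂ) ^ 2 := fun x => by
    rw [map_mul, mul_apply_eq_comp, ← inner_rep_left, inner_self_eq_norm_sq_to_K]
    rfl
  constructor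
  · intro h x
    rw [h, key]
  · intro h x
    let f : M →ₗ[ℂ] ℂ := (innerₛₗ ℂ χ) ∘ₗ orbit π χ
    have hf : ∀ x, f x = inner ℂ χ (π x χ) := fun x => rfl
    have : (μ : M →ₗ[ℂ] ℂ) = f :=
      functional_ext_of_star_mul_self fun x => by
        rw [hf, key]
        exact h x
    rw [← hf, ← this]
    rfl

theorem norm_rep_le (π : M →⋆ₐ[ℂ] (H →L[ℂ] H)) (x : M) (ξ : H) : ‖π x ξ‖ ≤ ‖x‖ * ‖ξ‖ :=
  ((π x).le_opNorm ξ).trans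
    (mul_le_mul_of_nonneg_right (NonUnitalStarAlgHom.norm_apply_le π x) (norm_nonneg _))

/-- The vector form `x ↦ ⟨π(x)χ, χ⟩`. -/
def vectorForm (π : M →⋆ₐ[ℂ] (H →L[ℂ] H)) (χ : H) : M →L[ℂ] ℂ :=
  innerSL ℂ χ ∘L (orbit π χ).mkContinuous ‖χ‖ fun x => by
    rw [mul_comm]
    exact norm_rep_le π x χ

theorem vectorForm_apply (π : M →⋆ₐ[ℂ] (H →L[ℂ] H)) (χ : H) (x : M) :
    vectorForm π χ x = inner ℂ χ (π x χ) := rfl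

theorem mem_fibre_vectorForm (π : M →⋆ₐ[ℂ] (H →L[ℂ] H)) (χ : H) : χ ∈ fibre π (vectorForm π χ) :=
  fun _ => rfl

theorem eq_vectorForm {π : M →⋆ₐ[ℂ] (H →L[ℂ] H)} {μ : M →L[ℂ] ℂ} {χ : H} (h : χ ∈ fibre π μ) :
    μ = vectorForm π χ := by
  ext x
  exact h x

theorem vectorForm_star_mul_self (π : M →⋆ₐ[ℂ] (H →L[ℂ] H)) (χ : H) (x : M) :
    vectorForm π χ (star x * x) = (‖π x χ‖ : ℂ) ^ 2 :=
  (mem_fibre_iff π _ χ).1 (mem_fibre_vectorForm π χ) x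

theorem norm_vectorForm (π : M →⋆ₐ[ℂ] (H →L[ℂ] H)) (χ : H) : ‖vectorForm π χ‖ = ‖χ‖ ^ 2 := by
  apply le_antisymm
  · refine ContinuousLinearMap.opNorm_le_bound _ (by positivity) fun x => ?_
    rw [vectorForm_apply]
    calc ‖inner ℂ χ (π x χ)‖ ≤ ‖χ‖ * (‖x‖ * ‖χ‖) :=
          (norm_inner_le_norm _ _).trans
            (mul_le_mul_of_nonneg_left (norm_rep_le π x χ) (norm_nonneg _))
      _ = _ := by ring
  · have h := (vectorForm π χ).le_opNorm 1
    rw [vectorForm_apply, map_one, one_apply_eq_self, inner_self_eq_norm_sq_to_K,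
      norm_pow, RCLike.norm_ofReal, abs_norm] at h
    refine h.trans (mul_le_of_le_one_right (norm_nonneg _) ?_)
    rcases subsingleton_or_nontrivial M with hM | hM
    · rw [Subsingleton.elim (1 : M) 0, norm_zero]
      exact zero_le_one
    · exact CStarRing.norm_one.le

/-- Every positive form is a vector form in some representation. -/
theorem exists_rep_of_isPositiveForm (τ : M →L[ℂ] ℂ) (hτ : IsPositiveForm τ) :
    ∃ (K : Type u) (_ : NormedAddCommGroup K) (_ : InnerProductSpace ℂ K) (_ : CompleteSpace K)
      (π : M →⋆ₐ[ℂ] (K →L[ℂ] K)) (ξ : K), ξ ∈ fibre π τ := by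
  -- `M` carries no order here; the spectral order makes the GNS construction applicable.
  let _ : PartialOrder M := CStarAlgebra.spectralOrder M
  have : StarOrderedRing M := CStarAlgebra.spectralOrderedRing M
  let f : M →ₚ[ℂ] ℂ := PositiveLinearMap.mk₀ (τ : M →ₗ[ℂ] ℂ) fun x hx => by
    obtain ⟨y, rfl⟩ := (CStarAlgebra.nonneg_iff_eq_star_mul_self).1 hx
    exact hτ y
  refine ⟨f.GNS, inferInstance, inferInstance, inferInstance, f.gnsStarAlgHom,
    ((f.toPreGNS 1 : f.PreGNS) : f.GNS), fun x => ?_⟩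
  have h : f.gnsStarAlgHom x ((f.toPreGNS 1 : f.PreGNS) : f.GNS) =
      ((f.leftMulMapPreGNS x (f.toPreGNS 1) : f.PreGNS) : f.GNS) :=
    PositiveLinearMap.gnsNonUnitalStarAlgHom_apply_coe f
  rw [h, UniformSpace.Completion.inner_coe, PositiveLinearMap.preGNS_inner_def]
  simp [f]
  rfl

end Intertwiner

/-! ### Normal positive forms and their supports -/

section NormalForms

open scoped ENNReal

variable {H : Type v} [NormedAddCommGroup H] [InnerProductSpace ℂ H] [CompleteSpace H]

/-- The ampliation `z ⊗ 1` on `ℓ²(ℕ, H)`. -/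
def ampliation (z : H →L[ℂ] H) : lp (fun _ : ℕ => H) 2 →L[ℂ] lp (fun _ : ℕ => H) 2 :=
  lp.mapCLM 2 (fun _ => z) (norm_nonneg z) fun _ => le_rfl

omit [CompleteSpace H] in
theorem ampliation_apply (z : H →L[ℂ] H) (x : lp (fun _ : ℕ => H) 2) (n : ℕ) :
    ampliation z x n = z (x n) := rfl

theorem inner_ampliation (z : H →L[ℂ] H) (x y : lp (fun _ : ℕ => H) 2) :
    inner ℂ y (ampliation z x) = inner ℂ (ampliation (star z) y) x := by
  rw [lp.inner_eq_tsum, lp.inner_eq_tsum]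
  refine tsum_congr fun n => ?_
  rw [ampliation_apply, ampliation_apply, ContinuousLinearMap.star_eq_adjoint,
    ContinuousLinearMap.adjoint_inner_left]

omit [InnerProductSpace ℂ H] [CompleteSpace H] in
theorem memℓp_two_of_summable {x : ℕ → H} (hx : Summable fun n => ‖x n‖ ^ 2) : Memℓp x 2 :=
  memℓp_gen (by simpa using hx)

/-- A normal positive form is given by sequences `χ`, `y` such that `χ` is killed by the left kernel
of the form. -/
theorem exists_sequences_of_normal_of_positive (N : StarSubalgebra ℂ (H →L[ℂ] H)) (g : N →ₗ[ℂ] ℂ)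
    (hn : IsNormalForm N g) (hg : ∀ z : N, 0 ≤ g (star z * z)) :
    ∃ χ y : ℕ → H, (∀ z : N, HasSum (fun n => inner ℂ (y n) ((z : H →L[ℂ] H) (χ n))) (g z)) ∧
      ∀ z : N, g (star z * z) = 0 → ∀ n, (z : H →L[ℂ] H) (χ n) = 0 := by
  obtain ⟨x, y, hx, hy, hs⟩ := hn
  let X : lp (fun _ : ℕ => H) 2 := ⟨x, memℓp_two_of_summable hx⟩
  let Y : lp (fun _ : ℕ => H) 2 := ⟨y, memℓp_two_of_summable hy⟩
  have hgXY : ∀ z : N, g z = inner ℂ Y (ampliation (z : H →L[ℂ] H) X) := fun z =>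
    (hs z).unique (lp.hasSum_inner Y (ampliation (z : H →L[ℂ] H) X))
  let r : N →ₗ[ℂ] lp (fun _ : ℕ => H) 2 :=
    { toFun := fun z => ampliation (z : H →L[ℂ] H) Y
      map_add' := fun z w => by ext n; simp [ampliation_apply]
      map_smul' := fun c z => by ext n; simp [ampliation_apply] }
  have hr : ∀ z : N, r z = ampliation (z : H →L[ℂ] H) Y := fun _ => rfl
  set V := (LinearMap.range r).topologicalClosure with hVdef
  have hrV : ∀ z, r z ∈ V := fun z => Submodule.le_topologicalClosure _ ⟨z, rfl⟩
  have hinv : ∀ z : N, ∀ ξ ∈ V, ampliation (z : H →L[ℂ] H) ξ ∈ V := by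
    intro z
    have h : (V : Set _) ⊆ ampliation (z : H →L[ℂ] H) ⁻¹' (V : Set _) := by
      rw [hVdef, Submodule.topologicalClosure_coe]
      refine closure_minimal ?_
        (isClosed_closure.preimage (ampliation (z : H →L[ℂ] H)).continuous)
      rintro _ ⟨w, rfl⟩
      refine subset_closure ⟨z * w, ?_⟩
      ext n
      simp [hr, ampliation_apply]
    exact fun ξ hξ => h hξ
  -- As `V` is the closure of `NY`, replacing `X` by its projection to `V` leaves the form
  -- unchanged. In return, vectors `zχ` remain in `V`, where they are tested by the numbers `⟨aY,
  -- zχ⟩ = g(a*z)`.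
  let χ := V.starProjection X
  have hχ : χ ∈ V := V.starProjection_apply_mem X
  have hgχ : ∀ z : N, g z = inner ℂ Y (ampliation (z : H →L[ℂ] H) χ) := by
    intro z
    rw [hgXY, inner_ampliation, inner_ampliation]
    have h := (Submodule.mem_orthogonal V _).1 (V.sub_starProjection_mem_orthogonal X) _
      (hrV (star z))
    rw [inner_sub_right] at h
    exact sub_eq_zero.1 h
  refine ⟨χ, y, fun z => ?_, fun z hz n => ?_⟩
  · rw [hgχ]
    exact lp.hasSum_inner Y (ampliation (z : H →L[ℂ] H) χ)
  · have h0 : ∀ ξ ∈ V, inner ℂ ξ (ampliation (z : H →L[ℂ] H) χ) = 0 := by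
      have h : (V : Set _) ⊆ {ξ | inner ℂ ξ (ampliation (z : H →L[ℂ] H) χ) = 0} := by
        rw [hVdef, Submodule.topologicalClosure_coe]
        refine closure_minimal ?_ (isClosed_eq (by fun_prop) continuous_const)
        rintro _ ⟨a, rfl⟩
        have h1 := positive_mul_eq_zero g hg hz (star a)
        rw [hgχ] at h1
        have h2 : ampliation ((star a * z : N) : H →L[ℂ] H) χ =
            ampliation (star (a : H →L[ℂ] H)) (ampliation (z : H →L[ℂ] H) χ) := by
          ext n
          simp [ampliation_apply]
        rw [h2, inner_ampliation, star_star] at h1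
        exact h1
      exact fun ξ hξ => h hξ
    have h1 := inner_self_eq_zero.1 (h0 _ (hinv z χ hχ))
    rw [← ampliation_apply, h1]
    rfl

theorem support_isStarProjection (N : StarSubalgebra ℂ (H →L[ℂ] H)) (g : N →ₗ[ℂ] ℂ) :
    IsStarProjection (support N g) :=
  isStarProjection_starProjection

variable {M : Type u} [CStarAlgebra M]

theorem commutant_apply {π : M →⋆ₐ[ℂ] (H →L[ℂ] H)} (z : commutant π) (x : M) (ξ : H) :
    (z : H →L[ℂ] H) (π x ξ) = π x ((z : H →L[ℂ] H) ξ) :=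
  DFunLike.congr_fun ((mem_commutant_iff π _).1 z.2 x) ξ

theorem mem_commutant_of_apply {π : M →⋆ₐ[ℂ] (H →L[ℂ] H)} {z : H →L[ℂ] H}
    (h : ∀ x ξ, z (π x ξ) = π x (z ξ)) : z ∈ commutant π :=
  (mem_commutant_iff π _).2 fun x => ContinuousLinearMap.ext (h x)

theorem starProjection_mem_commutant (π : M →⋆ₐ[ℂ] (H →L[ℂ] H)) (V : Submodule ℂ H)
    [V.HasOrthogonalProjection] (hV : ∀ x, ∀ ξ ∈ V, π x ξ ∈ V) :
    V.starProjection ∈ commutant π :=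
  mem_commutant_of_apply (rep_starProjection π V hV)

theorem support_mem_commutant (π : M →⋆ₐ[ℂ] (H →L[ℂ] H)) (g : commutant π →ₗ[ℂ] ℂ) :
    support (commutant π) g ∈ commutant π := by
  refine starProjection_mem_commutant π _ (rep_mem_closure π _ fun x ξ hξ => ?_)
  rw [Submodule.mem_iInf] at hξ ⊢
  rintro p
  obtain ⟨η, hη⟩ := hξ p
  exact ⟨π x η, by rw [← hη]; exact commutant_apply _ _ _⟩

section Support

variable {π : M →⋆ₐ[ℂ] (H →L[ℂ] H)} {g : commutant π →ₗ[ℂ] ℂ}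

/-- Each projection `p` with `g(1 - p) = 0` fixes the representing vectors `χ n`, because `1 - p` is
in the left kernel. So these vectors lie in the range of the support. -/
theorem map_mul_support (hn : IsNormalForm (commutant π) g)
    (hg : ∀ z : commutant π, 0 ≤ g (star z * z)) {s : commutant π}
    (hs : (s : H →L[ℂ] H) = support (commutant π) g) (z : commutant π) : g (z * s) = g z := by
  obtain ⟨χ, y, hsum, hker⟩ := exists_sequences_of_normal_of_positive _ g hn hg
  have hχ : ∀ n, (s : H →L[ℂ] H) (χ n) = χ n := by
    intro n
    rw [hs, support, Submodule.starProjection_eq_self_iff]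
    refine Submodule.le_topologicalClosure _ ?_
    rw [Submodule.mem_iInf]
    rintro ⟨p, hp, hgp⟩
    have h1 : g (star (1 - p) * (1 - p)) = 0 := by
      rw [hp.one_sub.isSelfAdjoint.star_eq, hp.one_sub.isIdempotentElem.eq, hgp]
    have h2 := hker _ h1 n
    refine ⟨χ n, ?_⟩
    simp only [AddSubgroupClass.coe_sub, OneMemClass.coe_one, sub_apply,
      one_apply_eq_self] at h2
    exact (sub_eq_zero.1 h2).symm
  refine (hsum (z * s)).unique ?_
  convert hsum z using 3 with n
  rw [MulMemClass.coe_mul, mul_apply_eq_comp, hχ]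

/-- Faithfulness of `g` on its support: the projection onto the kernel of `z` competes in the
infimum that defines the support, so the range of `s` lies in that kernel. -/
theorem mul_support_eq_zero (hn : IsNormalForm (commutant π) g)
    (hg : ∀ z : commutant π, 0 ≤ g (star z * z)) {s : commutant π}
    (hs : (s : H →L[ℂ] H) = support (commutant π) g) {z : commutant π}
    (hz : g (star z * z) = 0) : z * s = 0 := by
  obtain ⟨χ, y, hsum, hker⟩ := exists_sequences_of_normal_of_positive _ g hn hg
  set W := LinearMap.ker (z : H →L[ℂ] H).toLinearMap with hW
  have hWc : IsClosed (W : Set H) := (z : H →L[ℂ] H).isClosed_ker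
  have : CompleteSpace W := hWc.completeSpace_coe
  have hmem : ∀ ξ, ξ ∈ W ↔ (z : H →L[ℂ] H) ξ = 0 := fun ξ => LinearMap.mem_ker
  let q : commutant π := ⟨W.starProjection, starProjection_mem_commutant π W fun x ξ hξ => by
    rw [hmem] at hξ ⊢
    rw [commutant_apply, hξ, map_zero]⟩
  have hq : IsStarProjection q := by
    have h : IsStarProjection W.starProjection := isStarProjection_starProjection
    exact ⟨Subtype.ext h.isIdempotentElem, Subtype.ext h.isSelfAdjoint⟩
  have hgq : g (1 - q) = 0 := by
    refine (hsum (1 - q)).unique ?_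
    convert hasSum_zero with n
    have h1 : W.starProjection (χ n) = χ n :=
      Submodule.starProjection_eq_self_iff.2 ((hmem _).2 (hker z hz n))
    simp [q, h1]
  ext ξ
  have hr : (s : H →L[ℂ] H) ξ ∈ (W : Set H) := by
    rw [hs, support]
    have h1 := Submodule.starProjection_apply_mem (⨅ p : {p : commutant π //
      IsStarProjection p ∧ g (1 - p) = 0}, ((p : commutant π) : H →L[ℂ] H).range).topologicalClosure ξ
    refine closure_minimal ?_ hWc h1
    intro η hη
    obtain ⟨ζ, hζ⟩ := (Submodule.mem_iInf _).1 hη ⟨q, hq, hgq⟩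
    rw [← hζ]
    exact W.starProjection_apply_mem ζ
  exact (hmem _).1 hr

end Support

end NormalForms

/-! ### Weak operator compactness of the unit ball of the commutant -/

section WeakCompactness

open Filter Topology

variable {H : Type v} [NormedAddCommGroup H] [InnerProductSpace ℂ H] [CompleteSpace H]

/-- Weak operator limits of contractions along an ultrafilter exist. -/
theorem exists_weak_limit_of_contractions {ι : Type*} (U : Ultrafilter ι) (z : ι → H →L[ℂ] H)
    (hz : ∀ i, ‖z i‖ ≤ 1) : ∃ w : H →L[ℂ] H, ‖w‖ ≤ 1 ∧
      ∀ ξ η, Tendsto (fun i => inner ℂ (z i ξ) η) U (𝓝 (inner ℂ (w ξ) η)) := by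
  have hbd : ∀ ξ η i, ‖inner ℂ (z i ξ) η‖ ≤ ‖ξ‖ * ‖η‖ := fun ξ η i =>
    (norm_inner_le_norm _ _).trans (mul_le_mul_of_nonneg_right
      (by simpa using (z i).le_of_opNorm_le (hz i) ξ) (norm_nonneg _))
  have hlim : ∀ ξ η, ∃ c, Tendsto (fun i => inner ℂ (z i ξ) η) U (𝓝 c) := by
    intro ξ η
    obtain ⟨c, -, hc⟩ := (isCompact_closedBall (0 : ℂ) (‖ξ‖ * ‖η‖)).ultrafilter_le_nhds
      (U.map fun i => inner ℂ (z i ξ) η)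
      (le_principal_iff.2 (Ultrafilter.mem_map.2 (univ_mem' fun i => by simpa using hbd ξ η i)))
    exact ⟨c, hc⟩
  choose B hB using hlim
  let L : H →ₗ⋆[ℂ] H →ₗ[ℂ] ℂ := LinearMap.mk₂'ₛₗ (starRingEnd ℂ) (RingHom.id ℂ) B
    (fun a b c => tendsto_nhds_unique (hB _ _)
      (by simpa [inner_add_left] using (hB a c).add (hB b c)))
    (fun r a c => tendsto_nhds_unique (hB _ _)
      (by simpa [inner_smul_left, mul_comm] using (hB a c).const_mul ((starRingEnd ℂ) r)))
    (fun a b c => tendsto_nhds_unique (hB _ _)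
      (by simpa [inner_add_right] using (hB a b).add (hB a c)))
    (fun r a c => tendsto_nhds_unique (hB _ _)
      (by simpa [inner_smul_right] using (hB a c).const_mul r))
  have hL : ∀ ξ η, ‖L ξ η‖ ≤ 1 * ‖ξ‖ * ‖η‖ := fun ξ η => by
    rw [one_mul]
    exact le_of_tendsto (hB ξ η).norm (Eventually.of_forall (hbd ξ η))
  let w := InnerProductSpace.continuousLinearMapOfBilin (L.mkContinuous₂ 1 hL)
  have hw : ∀ ξ η, inner ℂ (w ξ) η = B ξ η := fun ξ η =>
    InnerProductSpace.continuousLinearMapOfBilin_apply _ _ _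
  refine ⟨w, ContinuousLinearMap.opNorm_le_bound _ zero_le_one fun ξ => ?_, fun ξ η => ?_⟩
  · have h1 := hL ξ (w ξ)
    change ‖B ξ (w ξ)‖ ≤ _ at h1
    rw [← hw, inner_self_eq_norm_sq_to_K, norm_pow, RCLike.norm_ofReal, abs_norm, sq,
      one_mul] at h1
    rw [one_mul]
    rcases (norm_nonneg (w ξ)).eq_or_lt with h0 | h0
    · rw [← h0]
      exact norm_nonneg ξ
    · exact le_of_mul_le_mul_right h1 h0
  · rw [hw]
    exact hB ξ η

variable {M : Type u} [CStarAlgebra M]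

/-- A weak operator limit of a maximizing sequence is again a contraction in the commutant, and
vector forms are continuous along such limits. -/
theorem exists_maximizing_contraction (π : M →⋆ₐ[ℂ] (H →L[ℂ] H)) (ψ φ : H) :
    ∃ w : commutant π, ‖(w : H →L[ℂ] H)‖ ≤ 1 ∧ ∀ z : commutant π, ‖(z : H →L[ℂ] H)‖ ≤ 1 →
      (transitionForm π ψ φ z).re ≤ (transitionForm π ψ φ w).re := by
  set S : Set ℝ := {r | ∃ z : commutant π, ‖(z : H →L[ℂ] H)‖ ≤ 1 ∧ r = (transitionForm π ψ φ z).re}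
  have hS : S.Nonempty := ⟨_, 0, by simp, rfl⟩
  have hSb : BddAbove S := by
    refine ⟨‖φ‖ * ‖ψ‖, ?_⟩
    rintro _ ⟨z, hz, rfl⟩
    refine (Complex.re_le_norm _).trans ((norm_inner_le_norm _ _).trans ?_)
    exact mul_le_mul_of_nonneg_left (by simpa using (z : H →L[ℂ] H).le_of_opNorm_le hz ψ)
      (norm_nonneg _)
  obtain ⟨r, -, hr, hrS⟩ := exists_seq_tendsto_sSup hS hSb
  choose z hz hrz using hrS
  obtain ⟨w, hw, hlim⟩ := exists_weak_limit_of_contractions (hyperfilter ℕ)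
    (fun n => (z n : H →L[ℂ] H)) hz
  have hwc : w ∈ commutant π := by
    refine mem_commutant_of_apply fun x ξ => ext_inner_right ℂ fun η => ?_
    refine tendsto_nhds_unique (hlim (π x ξ) η) ?_
    rw [inner_rep_left]
    simpa only [commutant_apply, inner_rep_left] using hlim ξ (π (star x) η)
  refine ⟨⟨w, hwc⟩, hw, fun y hy => ?_⟩
  have h1 : Tendsto r (hyperfilter ℕ) (𝓝 (transitionForm π ψ φ ⟨w, hwc⟩).re) := by
    have h2 := (Complex.continuous_re.tendsto _).comp (hlim ψ φ)
    have h3 : ∀ u : commutant π, (transitionForm π ψ φ u).re =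
        (inner ℂ ((u : H →L[ℂ] H) ψ) φ : ℂ).re := fun u => inner_re_symm (𝕜 := ℂ) _ _
    simp only [h3] at hrz ⊢
    refine h2.congr fun n => ?_
    rw [hrz]
    rfl
  have h2 := tendsto_nhds_unique h1 (hr.mono_left Nat.hyperfilter_le_atTop)
  rw [h2]
  exact le_csSup hSb ⟨y, hy, rfl⟩

end WeakCompactness

/-! ### Functionals attaining their norm at the unit -/

section Positivity

variable {H : Type v} [NormedAddCommGroup H] [InnerProductSpace ℂ H] [CompleteSpace H]

/-- A functional on an operator *-algebra that attains its norm at `1` is positive. -/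
theorem positive_of_norm_attained_one (N : StarSubalgebra ℂ (H →L[ℂ] H)) (g : N →ₗ[ℂ] ℂ) {m : ℝ}
    (hg : ∀ z : N, ‖g z‖ ≤ m * ‖(z : H →L[ℂ] H)‖) (h1 : g 1 = m) (z : N) :
    0 ≤ g (star z * z) := by
  set a : N := star z * z with ha
  set T : H →L[ℂ] H := (a : H →L[ℂ] H) with hT
  have hTz : T = star (z : H →L[ℂ] H) * (z : H →L[ℂ] H) := rfl
  have hT0 : 0 ≤ T := hTz ▸ star_mul_self_nonneg _
  have hTs : IsSelfAdjoint T := hT0.isSelfAdjoint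
  have hm : 0 ≤ m := by
    rcases subsingleton_or_nontrivial H with hH | hH
    · have h2 : (1 : N) = 0 := Subtype.ext (Subsingleton.elim (1 : H →L[ℂ] H) 0)
      rw [h2, map_zero] at h1
      exact_mod_cast h1.le
    · have h2 := hg 1
      rw [OneMemClass.coe_one, norm_one, mul_one] at h2
      exact (norm_nonneg _).trans h2
  rw [Complex.nonneg_iff]
  constructor
  -- From `0 ≤ T ≤ ‖T‖` one gets `‖‖T‖ - T‖ ≤ ‖T‖`, so `m‖T‖ - Re g(a) ≤ m‖T‖`.
  · have hle : T ≤ algebraMap ℝ (H →L[ℂ] H) ‖T‖ := hTs.le_algebraMap_norm_self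
    have hn : ‖algebraMap ℝ (H →L[ℂ] H) ‖T‖ - T‖ ≤ ‖T‖ := by
      refine (CStarAlgebra.norm_le_norm_of_nonneg_of_le (sub_nonneg.2 hle)
        (sub_le_self _ hT0)).trans ?_
      rw [Algebra.algebraMap_eq_smul_one, norm_smul, norm_norm]
      exact mul_le_of_le_one_right (norm_nonneg _) ContinuousLinearMap.norm_id_le
    have h2 := hg (algebraMap ℂ N (‖T‖ : ℂ) - a)
    have h3 : ((algebraMap ℂ N (‖T‖ : ℂ) - a : N) : H →L[ℂ] H) =
        algebraMap ℝ (H →L[ℂ] H) ‖T‖ - T := by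
      ext ξ
      simp [Algebra.algebraMap_eq_smul_one, hT]
    rw [h3, Algebra.algebraMap_eq_smul_one, map_sub, map_smul, h1, smul_eq_mul] at h2
    have h4 := (Complex.re_le_norm _).trans (h2.trans (mul_le_mul_of_nonneg_left hn hm))
    simp only [Complex.sub_re, Complex.mul_re, Complex.ofReal_re, Complex.ofReal_im] at h4
    linarith
  -- Shifting by `it` gives `‖T + it‖² ≤ ‖T‖² + t²`, while `Im g` becomes `Im g(a) + tm`. The terms
  -- `t²m²` cancel, and what remains is linear in the arbitrary real `t`.
  · have key : ∀ t : ℝ, 2 * t * m * (g a).im ≤ m ^ 2 * ‖T‖ ^ 2 := by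
      intro t
      have h2 := hg (a + algebraMap ℂ N (t * Complex.I))
      have h3 : ‖((a + algebraMap ℂ N (t * Complex.I) : N) : H →L[ℂ] H)‖ ^ 2 ≤
          ‖T‖ ^ 2 + t ^ 2 := by
        rw [sq, ← CStarRing.norm_star_mul_self]
        have h4 : star ((a + algebraMap ℂ N (t * Complex.I) : N) : H →L[ℂ] H) *
            ((a + algebraMap ℂ N (t * Complex.I) : N) : H →L[ℂ] H) =
            T * T + algebraMap ℂ (H →L[ℂ] H) ((t : ℂ) ^ 2) := by
          have h5 : ((a + algebraMap ℂ N (t * Complex.I) : N) : H →L[ℂ] H) =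
            T + (t * Complex.I : ℂ) • (1 : H →L[ℂ] H) := by
            ext ξ
            simp [Algebra.algebraMap_eq_smul_one, hT]
          rw [h5, star_add, hTs.star_eq, star_smul, star_one, Algebra.algebraMap_eq_smul_one]
          simp only [add_mul, mul_add, smul_mul_assoc, mul_smul_comm, one_mul, mul_one, smul_add,
            smul_smul, RCLike.star_def, map_mul, Complex.conj_ofReal, Complex.conj_I]
          have h6 : (t : ℂ) * Complex.I * (t * -Complex.I) = (t : ℂ) ^ 2 := by
            linear_combination (-(t : ℂ) ^ 2) * Complex.I_sq
          rw [h6]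
          module
        rw [h4]
        refine (norm_add_le _ _).trans (add_le_add ((norm_mul_le _ _).trans (sq _).ge) ?_)
        rw [Algebra.algebraMap_eq_smul_one, norm_smul, norm_pow, Complex.norm_real,
          Real.norm_eq_abs, sq_abs]
        exact mul_le_of_le_one_right (sq_nonneg _) ContinuousLinearMap.norm_id_le
      have h4 : ((g a).im + t * m) ^ 2 ≤ m ^ 2 * (‖T‖ ^ 2 + t ^ 2) := by
        have h5 : (g (a + algebraMap ℂ N (t * Complex.I))).im = (g a).im + t * m := by
          rw [Algebra.algebraMap_eq_smul_one, map_add, map_smul, h1]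
          simp
        rw [← h5, ← sq_abs]
        refine (pow_le_pow_left₀ (abs_nonneg _) ((Complex.abs_im_le_norm _).trans h2) 2).trans ?_
        rw [mul_pow]
        exact mul_le_mul_of_nonneg_left h3 (sq_nonneg _)
      nlinarith [sq_nonneg (g a).im]
    rcases hm.eq_or_lt with h0 | h0
    · have h2 := hg a
      rw [← h0, zero_mul] at h2
      rw [norm_le_zero_iff.1 h2, Complex.zero_im]
    · by_contra hne
      have hne' : (g a).im ≠ 0 := fun h => hne h.symm
      -- This `t` turns the left side of `key` into `m²‖T‖² + 1`, a contradiction.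
      have h2 := key ((m ^ 2 * ‖T‖ ^ 2 + 1) / (2 * m * (g a).im))
      have h3 : 2 * ((m ^ 2 * ‖T‖ ^ 2 + 1) / (2 * m * (g a).im)) * m * (g a).im =
          m ^ 2 * ‖T‖ ^ 2 + 1 := by
        field_simp
      linarith

end Positivity

/-! ### Existence of the polar decomposition -/

section Polar

variable {M : Type u} [CStarAlgebra M]
variable {H : Type v} [NormedAddCommGroup H] [InnerProductSpace ℂ H] [CompleteSpace H]

theorem transitionForm_apply (π : M →⋆ₐ[ℂ] (H →L[ℂ] H)) (ψ φ : H) (z : commutant π) :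
    transitionForm π ψ φ z = inner ℂ φ ((z : H →L[ℂ] H) ψ) := rfl

theorem isNormalForm_vector (N : StarSubalgebra ℂ (H →L[ℂ] H)) (g : N →ₗ[ℂ] ℂ) (ξ η : H)
    (hg : ∀ z : N, g z = inner ℂ η ((z : H →L[ℂ] H) ξ)) : IsNormalForm N g := by
  refine ⟨Pi.single 0 ξ, Pi.single 0 η, ?_, ?_, fun z => ?_⟩
  · exact summable_of_ne_finset_zero (s := {0}) fun n hn => by
      rw [Pi.single_eq_of_ne (by simpa using hn)]
      simp
  · exact summable_of_ne_finset_zero (s := {0}) fun n hn => by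
      rw [Pi.single_eq_of_ne (by simpa using hn)]
      simp
  · rw [hg]
    convert hasSum_single 0 fun n hn => ?_ using 1
    · simp
    · rw [Pi.single_eq_of_ne hn, inner_zero_left]

/-- For a contraction `w` one has `‖wξ‖² + ‖(1 - w*w)ξ‖² ≤ ‖ξ‖²`. -/
theorem contraction_add_defect_sq_le {w : H →L[ℂ] H} (hw : ‖w‖ ≤ 1) (ξ : H) :
    ‖w ξ‖ ^ 2 + ‖ξ - star w (w ξ)‖ ^ 2 ≤ ‖ξ‖ ^ 2 := by
  have h1 : ‖star w (w ξ)‖ ≤ ‖w ξ‖ := by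
    have := (star w).le_of_opNorm_le ((norm_star w).trans_le hw) (w ξ)
    rwa [one_mul] at this
  have h2 : (inner ℂ ξ (star w (w ξ)) : ℂ).re = ‖w ξ‖ ^ 2 := by
    rw [ContinuousLinearMap.star_eq_adjoint, ContinuousLinearMap.adjoint_inner_right]
    exact inner_self_eq_norm_sq (𝕜 := ℂ) (w ξ)
  have h3 := norm_sub_sq (𝕜 := ℂ) ξ (star w (w ξ))
  change _ = _ - 2 * (inner ℂ ξ (star w (w ξ)) : ℂ).re + _ at h3
  rw [h2] at h3
  nlinarith [norm_nonneg (star w (w ξ)), norm_nonneg (w ξ)]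

/-- By Cauchy–Schwarz, `a + tb ≤ √(1 + t²) √(a² + b²) ≤ (1 + t²/2)‖ξ‖`. A perturbation of `w` inside
its defect costs only second order in `t`. -/
theorem norm_add_defect_le {w z : H →L[ℂ] H} (hw : ‖w‖ ≤ 1) (hz : ‖z‖ ≤ 1) {t : ℝ} (ht : 0 ≤ t) :
    ‖w + (t : ℂ) • (z * (1 - star w * w))‖ ≤ 1 + t ^ 2 / 2 := by
  refine ContinuousLinearMap.opNorm_le_bound _ (by positivity) fun ξ => ?_
  have h1 := contraction_add_defect_sq_le hw ξ
  set a := ‖w ξ‖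
  set b := ‖ξ - star w (w ξ)‖
  have h2 : ‖(w + (t : ℂ) • (z * (1 - star w * w))) ξ‖ ≤ a + t * b := by
    have h3 : (w + (t : ℂ) • (z * (1 - star w * w))) ξ = w ξ + (t : ℂ) • z (ξ - star w (w ξ)) := by
      simp
    rw [h3]
    refine (norm_add_le _ _).trans (add_le_add le_rfl ?_)
    rw [norm_smul, Complex.norm_real, Real.norm_of_nonneg ht]
    refine mul_le_mul_of_nonneg_left ?_ ht
    simpa using z.le_of_opNorm_le hz (ξ - star w (w ξ))
  refine h2.trans ?_
  refine abs_le_of_sq_le_sq' ?_ (by positivity) |>.2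
  have h3 : (a + t * b) ^ 2 ≤ (1 + t ^ 2) * (a ^ 2 + b ^ 2) := by nlinarith [sq_nonneg (t * a - b)]
  have h4 : (1 + t ^ 2) * (a ^ 2 + b ^ 2) ≤ (1 + t ^ 2 / 2) ^ 2 * ‖ξ‖ ^ 2 := by
    refine mul_le_mul ?_ h1 (by positivity) (by positivity)
    nlinarith [sq_nonneg (t ^ 2)]
  rw [mul_pow]
  exact h3.trans h4

/-- If `h` attains its norm at the contraction `w`, then `h` vanishes on `N(1 - w*w)`. -/
theorem map_mul_defect_eq_zero (N : StarSubalgebra ℂ (H →L[ℂ] H)) (h : N →ₗ[ℂ] ℂ) {m : ℝ}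
    {w : N} (hw : ‖(w : H →L[ℂ] H)‖ ≤ 1) (hm : ∀ z : N, ‖h z‖ ≤ m * ‖(z : H →L[ℂ] H)‖)
    (hwm : h w = m) (z : N) : h (z * (1 - star w * w)) = 0 := by
  have hm0 : 0 ≤ m := by
    have h2 := hm w
    rw [hwm, Complex.norm_real] at h2
    by_contra hneg
    push Not at hneg
    have h3 : m * ‖(w : H →L[ℂ] H)‖ ≤ 0 := mul_nonpos_of_nonpos_of_nonneg hneg.le (norm_nonneg _)
    have h4 := (norm_nonneg m).trans (h2)
    have h5 := norm_le_zero_iff.1 (h2.trans h3)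
    exact hneg.ne h5
  have key : ∀ z : N, ‖(z : H →L[ℂ] H)‖ ≤ 1 → (h (z * (1 - star w * w))).re ≤ 0 := by
    intro z hz
    by_contra hpos
    push Not at hpos
    set r := (h (z * (1 - star w * w))).re
    have h1 : ∀ t : ℝ, 0 ≤ t → m + t * r ≤ m * (1 + t ^ 2 / 2) := by
      intro t ht
      have h2 := hm (w + (t : ℂ) • (z * (1 - star w * w)))
      have h3 : ‖((w + (t : ℂ) • (z * (1 - star w * w)) : N) : H →L[ℂ] H)‖ ≤ 1 + t ^ 2 / 2 := by
        simpa using norm_add_defect_le hw hz ht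
      have h4 := (Complex.re_le_norm _).trans (h2.trans (mul_le_mul_of_nonneg_left h3 hm0))
      rw [map_add, map_smul, hwm] at h4
      simpa using h4
    -- The first-order gain `tr` beats the second-order cost `mt²/2` for small `t`; the summand `1`
    -- covers `m = 0`.
    have h2 := h1 (r / (m + 1)) (by positivity)
    have h3 : r / (m + 1) * r ≤ m * ((r / (m + 1)) ^ 2 / 2) := by linarith
    have h4 : 0 < m + 1 := by linarith
    have h5 : r = (r / (m + 1)) * (m + 1) := by field_simp
    have h6 : 0 < r / (m + 1) := by positivity
    set q := r / (m + 1)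
    rw [h5] at h3
    nlinarith [sq_nonneg q, mul_pos h6 h6]
  have key2 : ∀ z : N, (h (z * (1 - star w * w))).re ≤ 0 := by
    intro z
    rcases (norm_nonneg (z : H →L[ℂ] H)).eq_or_lt with h0 | h0
    · have : z = 0 := Subtype.ext (norm_eq_zero.1 h0.symm)
      simp [this]
    · have h1 := key ((((‖(z : H →L[ℂ] H)‖)⁻¹ : ℝ) : ℂ) • z) (by
        rw [SetLike.val_smul, norm_smul, Complex.norm_real, norm_inv, norm_norm,
          inv_mul_cancel₀ h0.ne'])
      rw [smul_mul_assoc, map_smul, smul_eq_mul, Complex.re_ofReal_mul] at h1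
      exact nonpos_of_mul_nonpos_right h1 (inv_pos.2 h0)
  have h1 := key2 z
  have h2 := key2 (-z)
  have h3 := key2 (Complex.I • z)
  have h4 := key2 (-(Complex.I • z))
  simp only [neg_mul, smul_mul_assoc, map_neg, map_smul, smul_eq_mul, Complex.neg_re,
    Complex.mul_re, Complex.I_re, Complex.I_im] at h2 h3 h4
  exact Complex.ext (by simpa using (by linarith : (h (z * (1 - star w * w))).re = 0))
    (by simpa using (by linarith : (h (z * (1 - star w * w))).im = 0))

/-- Every vector form on the commutant has a polar decomposition. -/
theorem exists_isPolarDecomposition (π : M →⋆ₐ[ℂ] (H →L[ℂ] H)) (ψ φ : H) :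
    ∃ q : (commutant π →ₗ[ℂ] ℂ) × commutant π,
      IsPolarDecomposition (commutant π) (transitionForm π ψ φ) q.1 q.2 := by
  obtain ⟨w, hw, hmax⟩ := exists_maximizing_contraction π ψ φ
  set h := transitionForm π ψ φ with hh
  set m := (h w).re with hmdef
  have hle : ∀ z : commutant π, (h z).re ≤ m * ‖(z : H →L[ℂ] H)‖ := by
    intro z
    rcases (norm_nonneg (z : H →L[ℂ] H)).eq_or_lt with h0 | h0
    · have : z = 0 := Subtype.ext (norm_eq_zero.1 h0.symm)
      simp [this]
    · have h1 := hmax ((((‖(z : H →L[ℂ] H)‖)⁻¹ : ℝ) : ℂ) • z) (by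
        rw [SetLike.val_smul, norm_smul, Complex.norm_real, norm_inv, norm_norm,
          inv_mul_cancel₀ h0.ne'])
      rw [map_smul, smul_eq_mul, Complex.re_ofReal_mul, inv_mul_le_iff₀ h0] at h1
      linarith
  have hm : ∀ z : commutant π, ‖h z‖ ≤ m * ‖(z : H →L[ℂ] H)‖ := by
    intro z
    obtain ⟨c, hc, hcz⟩ : ∃ c : ℂ, ‖c‖ ≤ 1 ∧ c * h z = ‖h z‖ := by
      rcases eq_or_ne (h z) 0 with h0 | h0
      · exact ⟨0, by simp, by simp [h0]⟩
      · refine ⟨(starRingEnd ℂ) (h z) / ‖h z‖, ?_, ?_⟩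
        · rw [norm_div, RCLike.norm_conj, Complex.norm_real, norm_norm,
            div_self (norm_ne_zero_iff.2 h0)]
        · have h2 : (‖h z‖ : ℂ) ≠ 0 := by exact_mod_cast norm_ne_zero_iff.2 h0
          rw [div_mul_eq_mul_div, Complex.conj_mul', sq, mul_div_assoc, div_self h2, mul_one]
    have h1 := hle (c • z)
    rw [map_smul, smul_eq_mul, hcz, Complex.ofReal_re, SetLike.val_smul, norm_smul] at h1
    have hm0 : 0 ≤ m := by simpa using hmax 0 (by simp)
    refine h1.trans (mul_le_mul_of_nonneg_left ?_ hm0)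
    exact mul_le_of_le_one_left (norm_nonneg _) hc
  have hwm : h w = m := by
    have h1 : ‖h w‖ ≤ m := (hm w).trans (mul_le_of_le_one_right (by simpa using hmax 0 (by simp)) hw)
    have h2 : (h w).re ^ 2 + (h w).im ^ 2 ≤ m ^ 2 := by
      have h3 := Complex.sq_norm (h w)
      rw [Complex.normSq_apply] at h3
      nlinarith [norm_nonneg (h w)]
    have h3 : (h w).im = 0 := by
      have : (h w).im ^ 2 ≤ 0 := by linarith
      exact pow_eq_zero_iff two_ne_zero |>.1 (le_antisymm this (sq_nonneg _))
    exact Complex.ext (by simp [hmdef]) (by simpa using h3)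
  have hdef := map_mul_defect_eq_zero _ h hw hm hwm
  -- Since `h` attains its norm `m` at `w`, the form `g` attains its bound at `1` and is positive.
  let g : commutant π →ₗ[ℂ] ℂ := h ∘ₗ LinearMap.mulRight ℂ w
  have hg : ∀ z, g z = h (z * w) := fun _ => rfl
  have hgpos : ∀ z, 0 ≤ g (star z * z) := by
    refine positive_of_norm_attained_one _ g (m := m) (fun z => (hm _).trans ?_) (by simp [hg, hwm])
    refine mul_le_mul_of_nonneg_left ?_ (by simpa using hmax 0 (by simp))
    exact (norm_mul_le _ _).trans (mul_le_of_le_one_right (norm_nonneg _) hw)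
  have hgn : IsNormalForm (commutant π) g :=
    isNormalForm_vector _ g ((w : H →L[ℂ] H) ψ) φ fun z => rfl
  let s : commutant π := ⟨support _ g, support_mem_commutant π g⟩
  have hs : (s : H →L[ℂ] H) = support _ g := rfl
  have hsp := support_isStarProjection (commutant π) g
  have hss : s * s = s := Subtype.ext hsp.isIdempotentElem
  have hsa : star s = s := Subtype.ext hsp.isSelfAdjoint
  have hgw : ∀ z, g (z * star w) = h z := fun z => by
    have h1 := hdef z
    rw [mul_sub, mul_one, map_sub, sub_eq_zero] at h1
    rw [hg, h1, mul_assoc]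
  -- As `h` vanishes on multiples of `1 - w*w`, the element `1 - ww*` lies in the left kernel of
  -- `g`.
  have h1 : (1 - w * star w) * s = 0 := by
    refine mul_support_eq_zero hgn hgpos hs ?_
    have h2 : star (1 - w * star w) * (1 - w * star w) =
        1 - w * star w - w * star w + w * star w * w * star w := by
      simp only [star_sub, star_one, star_mul, star_star]
      noncomm_ring
    rw [h2, map_add, map_sub, map_sub, hgw, hgw, hg, one_mul]
    have h3 := hgw (w * star w * w)
    rw [hg] at h3
    have h4 : h (w * star w * w) = h w := by
      rw [mul_assoc, ← hgw (w * (star w * w)), hg]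
      have h5 := hdef w
      rw [mul_sub, mul_one, map_sub, sub_eq_zero] at h5
      have h6 := hdef (w * (star w * w))
      rw [mul_sub, mul_one, map_sub, sub_eq_zero] at h6
      rw [mul_assoc _ (star w) w, ← h6, ← h5]
    rw [h4]
    ring
  rw [sub_mul, one_mul, sub_eq_zero] at h1
  -- The maximizer `w` need not be a partial isometry; cutting `w*` down by the support makes the
  -- initial projection exactly `s`.
  refine ⟨(g, star w * s), hgn, hgpos, ?_, fun z => ?_⟩
  · have h2 : star (star w * s) * (star w * s) = s := by
      rw [star_mul, star_star, hsa, mul_assoc, ← mul_assoc w, ← h1, hss]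
    rw [h2]
  · change h z = g (z * (star w * s))
    rw [← mul_assoc, map_mul_support hgn hgpos hs, hgw]

end Polar

/-! ### Properties and uniqueness of the polar decomposition -/

section PolarFacts

variable {M : Type u} [CStarAlgebra M]
variable {H : Type v} [NormedAddCommGroup H] [InnerProductSpace ℂ H] [CompleteSpace H]

theorem commutant_eq_zero_of_star_mul_self {π : M →⋆ₐ[ℂ] (H →L[ℂ] H)} {z : commutant π}
    (h : star z * z = 0) : z = 0 :=
  Subtype.ext (CStarRing.star_mul_self_eq_zero_iff (z : H →L[ℂ] H) |>.1 (congrArg Subtype.val h))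

/-- A positive form on the commutant is dominated on contractions by its value at `1`. -/
theorem positive_contraction_le {π : M →⋆ₐ[ℂ] (H →L[ℂ] H)} {g : commutant π →ₗ[ℂ] ℂ}
    (hg : ∀ z : commutant π, 0 ≤ g (star z * z)) {y : commutant π}
    (hy : ‖(y : H →L[ℂ] H)‖ ≤ 1) : (g (star y * y)).re ≤ (g 1).re := by
  set T : H →L[ℂ] H := 1 - star (y : H →L[ℂ] H) * y with hT
  have hT0 : 0 ≤ T := by
    have h1 : star (y : H →L[ℂ] H) * y ≤ algebraMap ℝ (H →L[ℂ] H) (‖(y : H →L[ℂ] H)‖ ^ 2) :=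
      CStarAlgebra.star_mul_le_algebraMap_norm_sq
    have h2 : algebraMap ℝ (H →L[ℂ] H) (‖(y : H →L[ℂ] H)‖ ^ 2) ≤ algebraMap ℝ (H →L[ℂ] H) 1 :=
      algebraMap_mono _ (pow_le_one₀ (norm_nonneg _) hy)
    rw [map_one] at h2
    exact sub_nonneg.2 (h1.trans h2)
  have hTc : T ∈ commutant π := sub_mem (one_mem _) (mul_mem (star_mem y.2) y.2)
  -- The square root lies in the commutant since functional calculus preserves commutation; so `1 -
  -- y*y` has the form `r*r` there.
  have hr : CFC.sqrt T ∈ commutant π := by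
    rw [mem_commutant_iff] at hTc ⊢
    intro x
    have h1 : Commute T (π x) := hTc x
    rw [CFC.sqrt_eq_cfc]
    exact (h1.cfc_nnreal NNReal.sqrt).eq
  let r : commutant π := ⟨CFC.sqrt T, hr⟩
  have hrr : star r * r = 1 - star y * y := by
    refine Subtype.ext ?_
    change star (CFC.sqrt T) * CFC.sqrt T = T
    rw [(CFC.sqrt_nonneg T).isSelfAdjoint.star_eq, CFC.sqrt_mul_sqrt_self T hT0]
  have h := (Complex.nonneg_iff.1 (hg r)).1
  rw [hrr, map_sub, Complex.sub_re] at h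
  linarith

namespace IsPolarDecomposition

variable {π : M →⋆ₐ[ℂ] (H →L[ℂ] H)} {h g : commutant π →ₗ[ℂ] ℂ} {v : commutant π}

theorem map_mul_initial (hp : IsPolarDecomposition (commutant π) h g v) (z : commutant π) :
    g (z * (star v * v)) = g z :=
  map_mul_support hp.normal hp.nonneg hp.initial z

theorem mul_initial_eq_zero (hp : IsPolarDecomposition (commutant π) h g v) {z : commutant π}
    (hz : g (star z * z) = 0) : z * (star v * v) = 0 :=
  mul_support_eq_zero hp.normal hp.nonneg hp.initial hz

theorem initial_idempotent (hp : IsPolarDecomposition (commutant π) h g v) :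
    (star v * v) * (star v * v) = star v * v := by
  refine Subtype.ext ?_
  rw [MulMemClass.coe_mul, hp.initial]
  exact (support_isStarProjection _ _).isIdempotentElem

theorem mul_initial (hp : IsPolarDecomposition (commutant π) h g v) : v * (star v * v) = v := by
  have hi := hp.initial_idempotent
  have h0 : v * (star v * v) - v = 0 := by
    apply commutant_eq_zero_of_star_mul_self
    have : star (v * (star v * v) - v) * (v * (star v * v) - v) =
        (star v * v) * (star v * v) * (star v * v) - (star v * v) * (star v * v)
          - (star v * v) * (star v * v) + star v * v := by
      simp only [star_sub, star_mul, star_star]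
      noncomm_ring
    rw [this, hi, hi]
    abel
  exact sub_eq_zero.1 h0

theorem initial_mul_star (hp : IsPolarDecomposition (commutant π) h g v) :
    (star v * v) * star v = star v := by
  have := congrArg star hp.mul_initial
  simpa only [star_mul, star_star] using this

theorem eq_map_mul_star (hp : IsPolarDecomposition (commutant π) h g v) (z : commutant π) :
    g z = h (z * star v) := by
  rw [hp.factor, mul_assoc, hp.map_mul_initial]

theorem norm_le_one (hp : IsPolarDecomposition (commutant π) h g v) : ‖(v : H →L[ℂ] H)‖ ≤ 1 := by
  have h1 : ‖star (v : H →L[ℂ] H) * v‖ ≤ 1 := by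
    have h2 := hp.initial
    rw [MulMemClass.coe_mul, StarMemClass.coe_star] at h2
    rw [h2, support]
    exact Submodule.starProjection_norm_le _
  rw [CStarRing.norm_star_mul_self] at h1
  nlinarith [norm_nonneg (v : H →L[ℂ] H)]

/-- Here `g((tv)*(tv)) = h((tv)*t) = 0`, and `g` is faithful on its support, which absorbs `v` from
the right. -/
theorem mul_phase_eq_zero (hp : IsPolarDecomposition (commutant π) h g v) {t : commutant π}
    (ht : ∀ z, h (z * t) = 0) : t * v = 0 := by
  have h1 : g (star (t * v) * (t * v)) = 0 := by
    rw [← mul_assoc, ← hp.factor]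
    exact ht _
  have h2 := hp.mul_initial_eq_zero h1
  rwa [mul_assoc, hp.mul_initial] at h2

/-- Expand `0 ≤ g((1 - y)*(1 - y))` and use `g(y*y) ≤ g(1)`. -/
theorem re_le (hp : IsPolarDecomposition (commutant π) h g v) {y : commutant π}
    (hy : ‖(y : H →L[ℂ] H)‖ ≤ 1) : (g y).re ≤ (g 1).re := by
  have h1 := (Complex.nonneg_iff.1 (hp.nonneg (1 - y))).1
  have h2 := positive_contraction_le hp.nonneg hy
  have h3 : star (1 - y) * (1 - y) = 1 - y - star y + star y * y := by
    rw [star_sub, star_one]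
    noncomm_ring
  rw [h3, map_add, map_sub, map_sub, positive_map_star g hp.nonneg y] at h1
  simp only [Complex.add_re, Complex.sub_re, Complex.conj_re] at h1
  linarith

/-- The equality case of `re_le`: then `1 - y` lies in the left kernel of `g`, so it vanishes on the
support. -/
theorem mul_initial_of_re_eq (hp : IsPolarDecomposition (commutant π) h g v) {y : commutant π}
    (hy : ‖(y : H →L[ℂ] H)‖ ≤ 1) (hre : (g y).re = (g 1).re) :
    y * (star v * v) = star v * v := by
  have h1 := hp.nonneg (1 - y)
  have h2 := positive_contraction_le hp.nonneg hy
  have h3 : star (1 - y) * (1 - y) = 1 - y - star y + star y * y := by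
    rw [star_sub, star_one]
    noncomm_ring
  have h4 : (g (star (1 - y) * (1 - y))).re ≤ 0 := by
    rw [h3, map_add, map_sub, map_sub, positive_map_star g hp.nonneg y]
    simp only [Complex.add_re, Complex.sub_re, Complex.conj_re]
    linarith
  rw [Complex.nonneg_iff] at h1
  have h5 := hp.mul_initial_eq_zero (z := 1 - y)
    (Complex.ext (le_antisymm h4 h1.1) h1.2.symm)
  rw [sub_mul, one_mul, sub_eq_zero] at h5
  exact h5.symm

/-- Uniqueness of the polar decomposition. -/
theorem unique {g₁ g₂ : commutant π →ₗ[ℂ] ℂ} {v₁ v₂ : commutant π}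
    (h₁ : IsPolarDecomposition (commutant π) h g₁ v₁)
    (h₂ : IsPolarDecomposition (commutant π) h g₂ v₂) : g₁ = g₂ ∧ v₁ = v₂ := by
  have hnorm : ∀ {a b : commutant π}, ‖(a : H →L[ℂ] H)‖ ≤ 1 → ‖(b : H →L[ℂ] H)‖ ≤ 1 →
      ‖((star a * b : commutant π) : H →L[ℂ] H)‖ ≤ 1 := fun {a b} ha hb => by
    rw [MulMemClass.coe_mul, StarMemClass.coe_star]
    refine (norm_mul_le _ _).trans (mul_le_one₀ ?_ (norm_nonneg _) hb)
    rwa [norm_star]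
  have e12 : ∀ z, g₁ z = g₂ (z * (star v₁ * v₂)) := fun z => by
    rw [h₁.eq_map_mul_star, h₂.factor, mul_assoc]
  have e21 : ∀ z, g₂ z = g₁ (z * (star v₂ * v₁)) := fun z => by
    rw [h₂.eq_map_mul_star, h₁.factor, mul_assoc]
  have le12 : (g₁ 1).re ≤ (g₂ 1).re := by
    rw [e12, one_mul]
    exact h₂.re_le (hnorm h₁.norm_le_one h₂.norm_le_one)
  have le21 : (g₂ 1).re ≤ (g₁ 1).re := by
    rw [e21, one_mul]
    exact h₁.re_le (hnorm h₂.norm_le_one h₁.norm_le_one)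
  have hy : (g₂ (star v₁ * v₂)).re = (g₂ 1).re := by
    have h3 := e12 1
    rw [one_mul] at h3
    rw [← h3]
    exact le_antisymm le12 le21
  -- Equality of the total masses forces `v₁*v₂` to be the identity on the support of `g₂`, that is,
  -- `v₁*v₂ = v₂*v₂`.
  have hys := h₂.mul_initial_of_re_eq (hnorm h₁.norm_le_one h₂.norm_le_one) hy
  rw [mul_assoc, h₂.mul_initial] at hys
  have hg : g₁ = g₂ := by
    ext z
    rw [e12, hys, h₂.map_mul_initial]
  refine ⟨hg, ?_⟩
  have hs : star v₁ * v₁ = star v₂ * v₂ := Subtype.ext (by rw [h₁.initial, h₂.initial, hg])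
  have hys' : star v₂ * v₁ = star v₂ * v₂ := by
    have := congrArg star hys
    simpa only [star_mul, star_star] using this
  have h0 : v₁ - v₂ = 0 := by
    apply commutant_eq_zero_of_star_mul_self
    rw [star_sub, sub_mul, mul_sub, mul_sub, hs, hys, hys']
    abel
  exact sub_eq_zero.1 h0

end IsPolarDecomposition

/-- The chosen polar pair of a vector form is a polar decomposition. -/
theorem isPolarDecomposition_polarPair (π : M →⋆ₐ[ℂ] (H →L[ℂ] H)) (ψ φ : H) :
    IsPolarDecomposition (commutant π) (transitionForm π ψ φ)
      (absForm (commutant π) (transitionForm π ψ φ))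
      (polarPair (commutant π) (transitionForm π ψ φ)).2 := by
  have hex := exists_isPolarDecomposition π ψ φ
  rw [absForm, polarPair, dif_pos hex]
  exact hex.choose_spec

end PolarFacts

/-! ### Direct sums of copies of a representation and the density argument -/

section DiagonalRepresentation

variable {M : Type u} [CStarAlgebra M]
variable {H : Type v} [NormedAddCommGroup H] [InnerProductSpace ℂ H] [CompleteSpace H]
variable {ι : Type*} [Fintype ι]

/-- The operator acting as `T` in every coordinate. -/
def diagOp (ι : Type*) [Fintype ι] (T : H →L[ℂ] H) :
    PiLp 2 (fun _ : ι => H) →L[ℂ] PiLp 2 (fun _ : ι => H) :=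
  ((PiLp.continuousLinearEquiv 2 ℂ fun _ : ι => H).symm : (ι → H) →L[ℂ] PiLp 2 fun _ : ι => H) ∘L
    (ContinuousLinearMap.pi fun i => T ∘L ContinuousLinearMap.proj i) ∘L
    ((PiLp.continuousLinearEquiv 2 ℂ fun _ : ι => H) : (PiLp 2 fun _ : ι => H) →L[ℂ] (ι → H))

omit [CompleteSpace H] in
@[simp] theorem diagOp_apply (T : H →L[ℂ] H) (ξ : PiLp 2 (fun _ : ι => H)) (i : ι) :
    diagOp ι T ξ i = T (ξ i) := rfl

/-- The direct sum of copies of a representation. -/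
def diagRep (ι : Type*) [Fintype ι] (π : M →⋆ₐ[ℂ] (H →L[ℂ] H)) :
    M →⋆ₐ[ℂ] (PiLp 2 (fun _ : ι => H) →L[ℂ] PiLp 2 (fun _ : ι => H)) where
  toFun x := diagOp ι (π x)
  map_one' := by ext ξ i; simp
  map_mul' x y := by ext ξ i; simp
  map_zero' := by ext ξ i; simp
  map_add' x y := by ext ξ i; simp
  commutes' c := by
    ext ξ i
    simp [Algebra.algebraMap_eq_smul_one]
  map_star' x := by
    rw [ContinuousLinearMap.star_eq_adjoint, ContinuousLinearMap.eq_adjoint_iff]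
    intro ξ η
    simp [PiLp.inner_apply, inner_rep_left]

@[simp] theorem diagRep_apply (π : M →⋆ₐ[ℂ] (H →L[ℂ] H)) (x : M) (ξ : PiLp 2 (fun _ : ι => H))
    (i : ι) : diagRep ι π x ξ i = π x (ξ i) := rfl

/-- Finitely many vectors version of von Neumann's density theorem. -/
theorem diagOp_mem_closure_orbit (π : M →⋆ₐ[ℂ] (H →L[ℂ] H)) {p : H →L[ℂ] H}
    (hp : ∀ (z : commutant π) ξ, p ((z : H →L[ℂ] H) ξ) = (z : H →L[ℂ] H) (p ξ))
    (ξ : PiLp 2 (fun _ : ι => H)) :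
    diagOp ι p ξ ∈ (LinearMap.range (orbit (diagRep ι π) ξ)).topologicalClosure := by
  classical
  set V := (LinearMap.range (orbit (diagRep ι π) ξ)).topologicalClosure
  have hV := rep_mem_closure (diagRep ι π) _ (rep_mem_range_orbit (diagRep ι π) ξ)
  have hξ : V.starProjection ξ = ξ :=
    Submodule.starProjection_eq_self_iff.2 (Submodule.le_topologicalClosure _ ⟨1, by simp⟩)
  let e : ι → H → PiLp 2 (fun _ : ι => H) := fun j η => WithLp.toLp 2 (Pi.single j η)
  -- Matrix entries of the projection onto the closed orbit. They lie in the commutant, hence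
  -- commute with `p`; so the diagonal operator of `p` maps the fixed vector `ξ` to a fixed vector.
  let q : ι → ι → H →L[ℂ] H := fun i j =>
    PiLp.proj 2 (fun _ : ι => H) i ∘L V.starProjection ∘L
      ((PiLp.continuousLinearEquiv 2 ℂ fun _ : ι => H).symm :
        (ι → H) →L[ℂ] PiLp 2 fun _ : ι => H) ∘L ContinuousLinearMap.single ℂ (fun _ : ι => H) j
  have hq : ∀ i j η, q i j η = V.starProjection (e j η) i := fun i j η => rfl
  have hqc : ∀ i j, q i j ∈ commutant π := by
    intro i j
    refine mem_commutant_of_apply fun x η => ?_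
    have h1 : e j (π x η) = diagRep ι π x (e j η) := by
      ext k
      rcases eq_or_ne k j with rfl | hk
      · simp [e]
      · simp [e, hk]
    rw [hq, hq, h1, rep_starProjection (diagRep ι π) V hV]
    rfl
  have hsum : ∀ (η : PiLp 2 (fun _ : ι => H)) i,
      V.starProjection η i = ∑ j, q i j (η j) := by
    intro η i
    have h1 : η = ∑ j, e j (η j) := by
      ext k
      simp [e, Finset.sum_pi_single]
    conv_lhs => rw [h1, map_sum]
    simp [hq]
  rw [← Submodule.starProjection_eq_self_iff]
  ext i
  rw [hsum]
  conv_rhs => rw [diagOp_apply, ← hξ, hsum, map_sum]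
  exact Finset.sum_congr rfl fun j _ => (hp ⟨q i j, hqc i j⟩ (ξ j)).symm

end DiagonalRepresentation

/-! ### Orthogonality of vector forms in terms of the commutant -/

section Orthogonality

variable {M : Type u} [CStarAlgebra M]
variable {H : Type v} [NormedAddCommGroup H] [InnerProductSpace ℂ H] [CompleteSpace H]

theorem inner_rep_right (π : M →⋆ₐ[ℂ] (H →L[ℂ] H)) (x : M) (ξ η : H) :
    inner ℂ ξ (π x η) = inner ℂ (π (star x) ξ) η := by
  rw [inner_rep_left, star_star]

/-- Orthogonality of vector forms excludes non-trivial intertwining of the vectors. -/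
theorem inner_intertwiner_eq_zero {K : Type*} [NormedAddCommGroup K] [InnerProductSpace ℂ K]
    [CompleteSpace K] (π : M →⋆ₐ[ℂ] (H →L[ℂ] H)) (π' : M →⋆ₐ[ℂ] (K →L[ℂ] K)) {φ : H} {χ : K}
    (horth : Orthogonal (vectorForm π' χ) (vectorForm π φ)) {B : K →L[ℂ] H}
    (hB : ∀ x ξ, B (π' x ξ) = π x (B ξ)) : inner ℂ φ (B χ) = 0 := by
  rw [Orthogonal, norm_vectorForm, norm_vectorForm] at horth
  set f := vectorForm π' χ - vectorForm π φ with hf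
  -- A contraction `x` nearly attaining `‖f‖` satisfies `π'(x)χ ≈ χ` and `π(x*)φ ≈ -φ`. Moving `x`
  -- across `B` shows that `⟨φ, Bχ⟩` is close to its own negative. A deficit of `δ²/2` bounds both
  -- errors by `δ`.
  have key : ∀ δ : ℝ, 0 < δ → 2 * ‖inner ℂ φ (B χ)‖ ≤ (‖B‖ * ‖φ‖ + ‖B‖ * ‖χ‖) * δ := by
    intro δ hδ
    obtain ⟨x₀, hx₀, hfx₀⟩ := f.exists_lt_apply_of_lt_opNorm
      (r := ‖f‖ - δ ^ 2 / 2) (by linarith [pow_pos hδ 2])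
    obtain ⟨x, hx, hfx⟩ : ∃ x, ‖x‖ ≤ 1 ∧ ‖f‖ - δ ^ 2 / 2 < (f x).re := by
      rcases eq_or_ne (f x₀) 0 with h0 | h0
      · exact ⟨x₀, hx₀.le, by simpa [h0] using hfx₀⟩
      · refine ⟨((starRingEnd ℂ) (f x₀) / ‖f x₀‖ : ℂ) • x₀, ?_, ?_⟩
        · rw [norm_smul, norm_div, RCLike.norm_conj, Complex.norm_real, norm_norm,
            div_self (norm_ne_zero_iff.2 h0), one_mul]
          exact hx₀.le
        · have h2 : (‖f x₀‖ : ℂ) ≠ 0 := by exact_mod_cast norm_ne_zero_iff.2 h0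
          rw [map_smul, smul_eq_mul, div_mul_eq_mul_div, Complex.conj_mul',
            pow_two (‖f x₀‖ : ℂ), mul_div_assoc, div_self h2, mul_one, Complex.ofReal_re]
          exact hfx₀
    have hre : (f x).re = (inner ℂ χ (π' x χ) : ℂ).re - (inner ℂ φ (π x φ) : ℂ).re := by
      simp [hf, vectorForm_apply]
    have n1 : ‖π' x χ‖ ≤ ‖χ‖ :=
      (norm_rep_le π' x χ).trans (mul_le_of_le_one_left (norm_nonneg _) hx)
    have n2 : ‖π (star x) φ‖ ≤ ‖φ‖ :=
      (norm_rep_le π _ φ).trans (mul_le_of_le_one_left (norm_nonneg _) (by rwa [norm_star]))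
    have s1 : ‖χ - π' x χ‖ ^ 2 ≤ 2 * (‖χ‖ ^ 2 - (inner ℂ χ (π' x χ) : ℂ).re) := by
      have := norm_sub_sq (𝕜 := ℂ) χ (π' x χ)
      change _ = _ - 2 * (inner ℂ χ (π' x χ) : ℂ).re + _ at this
      nlinarith [norm_nonneg (π' x χ)]
    have s2 : ‖φ + π (star x) φ‖ ^ 2 ≤ 2 * (‖φ‖ ^ 2 + (inner ℂ φ (π x φ) : ℂ).re) := by
      have h1 := norm_add_sq (𝕜 := ℂ) φ (π (star x) φ)
      rw [← inner_rep_left, ← inner_re_symm] at h1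
      change _ = _ + 2 * (inner ℂ φ (π x φ) : ℂ).re + _ at h1
      nlinarith [norm_nonneg (π (star x) φ)]
    have l1 : (inner ℂ χ (π' x χ) : ℂ).re ≤ ‖χ‖ ^ 2 :=
      by nlinarith [sq_nonneg ‖χ - π' x χ‖]
    have l2 : 0 ≤ ‖φ‖ ^ 2 + (inner ℂ φ (π x φ) : ℂ).re := by
      nlinarith [sq_nonneg ‖φ + π (star x) φ‖]
    have t1 : ‖χ - π' x χ‖ ≤ δ := abs_le_of_sq_le_sq' (by linarith) hδ.le |>.2
    have t2 : ‖φ + π (star x) φ‖ ≤ δ := abs_le_of_sq_le_sq' (by linarith) hδ.le |>.2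
    have e : 2 * inner ℂ φ (B χ) = inner ℂ φ (B (χ - π' x χ)) + inner ℂ (φ + π (star x) φ) (B χ) := by
      rw [map_sub, inner_sub_right, inner_add_left, hB, inner_rep_right]
      ring
    have e2 : 2 * ‖inner ℂ φ (B χ)‖ = ‖2 * inner ℂ φ (B χ)‖ := by
      rw [norm_mul, Complex.norm_ofNat]
    rw [e2, e]
    refine (norm_add_le _ _).trans ?_
    have b1 : ‖inner ℂ φ (B (χ - π' x χ))‖ ≤ ‖φ‖ * (‖B‖ * δ) :=
      (norm_inner_le_norm _ _).trans (mul_le_mul_of_nonneg_left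
        ((B.le_opNorm _).trans (mul_le_mul_of_nonneg_left t1 (norm_nonneg _))) (norm_nonneg _))
    have b2 : ‖inner ℂ (φ + π (star x) φ) (B χ)‖ ≤ δ * (‖B‖ * ‖χ‖) :=
      (norm_inner_le_norm _ _).trans (mul_le_mul t2 (B.le_opNorm _) (norm_nonneg _) hδ.le)
    linarith
  set C := ‖B‖ * ‖φ‖ + ‖B‖ * ‖χ‖ with hC
  have hC0 : 0 ≤ C := by positivity
  have h0 : ‖inner ℂ φ (B χ)‖ ≤ 0 := by
    refine le_of_forall_pos_le_add fun ε hε => ?_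
    have h1 := key (ε / (C + 1)) (by positivity)
    have h2 : C * (ε / (C + 1)) ≤ ε := by
      rw [mul_div_assoc', div_le_iff₀ (by positivity)]
      nlinarith
    linarith [norm_nonneg (inner ℂ φ (B χ))]
  exact norm_le_zero_iff.1 h0

/-- The closure of the range of a real linear map into a complex Hilbert space, in terms of the
real parts of the inner products. -/
theorem mem_closure_range_of_real_linear {V : Type*} [AddCommGroup V] [Module ℂ V] (f : V → H)
    (hadd : ∀ x y, f (x + y) = f x + f y) (hsmul : ∀ (c : ℝ) x, f ((c : ℂ) • x) = (c : ℂ) • f x)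
    {t : H} (ht : ∀ u, (∀ x, (inner ℂ (f x) u : ℂ).re = 0) → (inner ℂ u t : ℂ).re = 0) :
    t ∈ closure (Set.range f) := by
  let _ : InnerProductSpace ℝ H := InnerProductSpace.complexToReal
  let R : V →ₗ[ℝ] H :=
    { toFun := f
      map_add' := hadd
      map_smul' := fun c x => by simpa using hsmul c x }
  have h : t ∈ (LinearMap.range R)ᗮᗮ := by
    rw [Submodule.mem_orthogonal]
    intro u hu
    rw [real_inner_eq_re_inner ℂ]
    refine ht u fun x => ?_
    have h1 := (Submodule.mem_orthogonal _ _).1 hu (R x) ⟨x, rfl⟩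
    rwa [real_inner_eq_re_inner ℂ] at h1
  rw [Submodule.orthogonal_orthogonal_eq_closure] at h
  exact h

/-- If the forms `⟨zχ, φ⟩` vanish for `z` in the commutant, some element of the algebra nearly
fixes `φ` while its adjoint nearly kills `χ`. -/
theorem exists_approximate_separation (π : M →⋆ₐ[ℂ] (H →L[ℂ] H)) {φ χ : H}
    (h : ∀ z : commutant π, inner ℂ φ ((z : H →L[ℂ] H) χ) = 0) {ε : ℝ} (hε : 0 < ε) :
    ∃ y : M, ‖π y φ - φ‖ ≤ ε ∧ ‖π (star y) χ‖ ≤ ε := by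
  -- the projection onto the closure of `Nφ`
  let r : commutant π →ₗ[ℂ] H :=
    { toFun := fun z => (z : H →L[ℂ] H) φ
      map_add' := fun z w => by simp
      map_smul' := fun c z => by simp }
  set W := (LinearMap.range r).topologicalClosure with hW
  have hrW : ∀ z : commutant π, (z : H →L[ℂ] H) φ ∈ W := fun z =>
    Submodule.le_topologicalClosure _ ⟨z, rfl⟩
  have hinv : ∀ z : commutant π, ∀ ξ ∈ W, (z : H →L[ℂ] H) ξ ∈ W := by
    intro z
    have h : (W : Set _) ⊆ (z : H →L[ℂ] H) ⁻¹' (W : Set _) := by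
      rw [hW, Submodule.topologicalClosure_coe]
      refine closure_minimal ?_ (isClosed_closure.preimage (z : H →L[ℂ] H).continuous)
      rintro _ ⟨w, rfl⟩
      exact subset_closure ⟨z * w, rfl⟩
    exact fun ξ hξ => h hξ
  have hp : ∀ (z : commutant π) ξ,
      W.starProjection ((z : H →L[ℂ] H) ξ) = (z : H →L[ℂ] H) (W.starProjection ξ) := by
    intro z ξ
    refine Submodule.eq_starProjection_of_mem_orthogonal
      (hinv _ _ (W.starProjection_apply_mem ξ)) ?_
    rw [← map_sub, Submodule.mem_orthogonal]
    intro u hu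
    rw [← ContinuousLinearMap.adjoint_inner_left, ← ContinuousLinearMap.star_eq_adjoint]
    exact (Submodule.mem_orthogonal W _).1 (W.sub_starProjection_mem_orthogonal ξ) _
      (hinv (star z) u hu)
  have hpφ : W.starProjection φ = φ := Submodule.starProjection_eq_self_iff.2 (hrW 1)
  have hpχ : W.starProjection χ = 0 := by
    rw [Submodule.starProjection_apply_eq_zero_iff, hW, Submodule.orthogonal_closure,
      Submodule.mem_orthogonal]
    rintro _ ⟨z, rfl⟩
    change inner ℂ ((z : H →L[ℂ] H) φ) χ = 0
    rw [← ContinuousLinearMap.adjoint_inner_right, ← ContinuousLinearMap.star_eq_adjoint]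
    exact h (star z)
  -- the annihilator of the real space of pairs `(π(x)φ, π(x*)χ)`
  let R : M → WithLp 2 (H × H) := fun x => WithLp.toLp 2 (π x φ, π (star x) χ)
  have hRdef : ∀ x, R x = WithLp.toLp 2 (π x φ, π (star x) χ) := fun _ => rfl
  -- The map `R` is only real linear because of the adjoint, so membership in the closure is tested
  -- by real parts of inner products.
  have hmem : WithLp.toLp 2 (φ, (0 : H)) ∈ closure (Set.range R) := by
    refine mem_closure_range_of_real_linear R (fun x y => ?_) (fun c x => ?_) ?_
    · rw [hRdef, hRdef, hRdef, ← WithLp.toLp_add]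
      simp
    · rw [hRdef, hRdef, ← WithLp.toLp_smul]
      simp [-Complex.coe_smul]
    intro u hu
    set ξ := u.fst
    set ζ := u.snd
    have hF : ∀ x : M, inner ℂ ξ (π x φ) + inner ℂ χ (π x ζ) = 0 := by
      have hre : ∀ x : M, (inner ℂ ξ (π x φ) + inner ℂ χ (π x ζ) : ℂ).re = 0 := by
        intro x
        have h1 := hu x
        rw [WithLp.prod_inner_apply, hRdef] at h1
        change (inner ℂ (π x φ) ξ + inner ℂ (π (star x) χ) ζ : ℂ).re = 0 at h1
        rw [inner_rep_left _ (star x), star_star, Complex.add_re] at h1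
        rw [Complex.add_re, ← h1]
        congr 1
        exact inner_re_symm (𝕜 := ℂ) _ _
      intro x
      apply Complex.ext (hre x)
      have h2 := hre (Complex.I • x)
      rw [map_smul, smul_apply, smul_apply, inner_smul_right, inner_smul_right, ← mul_add] at h2
      rw [Complex.I_mul_re] at h2
      exact neg_eq_zero.1 h2
    -- The relation says that `(ξ, χ)` is orthogonal to the orbit of `(φ, ζ)`. With `p` the
    -- projection onto `W`, the density argument puts `(pφ, pζ) = (φ, pζ)` in the closed orbit, and
    -- `pχ = 0` leaves `⟨ξ, φ⟩ = 0`.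
    have hG : ∀ η ∈ (LinearMap.range (orbit (diagRep (Fin 2) π)
        (WithLp.toLp 2 ![φ, ζ]))).topologicalClosure,
        inner ℂ (WithLp.toLp 2 ![ξ, χ] : PiLp 2 fun _ : Fin 2 => H) η = 0 := by
      intro η hη
      refine closure_minimal (t := {η | inner ℂ (WithLp.toLp 2 ![ξ, χ] : PiLp 2 fun _ : Fin 2 => H) η = 0})
        ?_ (isClosed_eq (by fun_prop) continuous_const) hη
      rintro _ ⟨x, rfl⟩
      simpa [PiLp.inner_apply, Fin.sum_univ_two] using hF x
    have h3 := hG _ (diagOp_mem_closure_orbit π hp (WithLp.toLp 2 ![φ, ζ]))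
    have h4 : inner ℂ χ (W.starProjection ζ) = 0 := by
      rw [← Submodule.inner_starProjection_left_eq_right, hpχ, inner_zero_left]
    simp only [PiLp.inner_apply, Fin.sum_univ_two, diagOp_apply] at h3
    change inner ℂ ξ (W.starProjection φ) + inner ℂ χ (W.starProjection ζ) = 0 at h3
    rw [hpφ, h4, add_zero] at h3
    rw [WithLp.prod_inner_apply]
    change (inner ℂ ξ φ + inner ℂ ζ (0 : H) : ℂ).re = 0
    rw [h3, inner_zero_right]
    simp
  obtain ⟨_, ⟨y, rfl⟩, hy⟩ := Metric.mem_closure_iff.1 hmem ε hε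
  rw [dist_comm, dist_eq_norm] at hy
  have hsq := WithLp.prod_norm_sq_eq_of_L2 (R y - WithLp.toLp 2 (φ, (0 : H)))
  have e1 : (R y - WithLp.toLp 2 (φ, (0 : H))).fst = π y φ - φ := rfl
  have e2 : (R y - WithLp.toLp 2 (φ, (0 : H))).snd = π (star y) χ - 0 := rfl
  rw [e1, e2, sub_zero] at hsq
  have hle : ‖R y - WithLp.toLp 2 (φ, (0 : H))‖ ^ 2 ≤ ε ^ 2 :=
    pow_le_pow_left₀ (norm_nonneg _) hy.le 2
  exact ⟨y, abs_le_of_sq_le_sq' (by nlinarith [sq_nonneg ‖π (star y) χ‖]) hε.le |>.2,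
    abs_le_of_sq_le_sq' (by nlinarith [sq_nonneg ‖π y φ - φ‖]) hε.le |>.2⟩

/-- For `y` in a C*-algebra and `t ≥ 0` there is a self-adjoint inverse `d` of `1 + t y y*` for which
`2d - 1` is a contraction. -/
theorem exists_resolvent (y : M) {t : ℝ} (ht : 0 ≤ t) :
    ∃ d : M, IsSelfAdjoint d ∧ d * (1 + (t : ℂ) • (y * star y)) = 1 ∧
      (1 + (t : ℂ) • (y * star y)) * d = 1 ∧ ‖(2 : ℂ) • d - 1‖ ≤ 1 := by
  set b := y * star y with hb
  have hbs : IsSelfAdjoint b := .mul_star_self y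
  have hspec : ∀ s ∈ spectrum ℝ b, 0 ≤ s := by
    have := spectrum_star_mul_self_nonneg (A := M) (b := star y)
    rwa [star_star] at this
  have hne : ∀ s ∈ spectrum ℝ b, 1 + t * s ≠ 0 := fun s hs =>
    (by have := mul_nonneg ht (hspec s hs); positivity)
  have hc : ContinuousOn (fun s : ℝ => (1 + t * s)⁻¹) (spectrum ℝ b) :=
    ContinuousOn.inv₀ (by fun_prop) hne
  have h1 : cfc (fun s : ℝ => 1 + t * s) b = 1 + (t : ℂ) • b := by
    rw [cfc_const_add (1 : ℝ) (fun s => t * s) b, cfc_const_mul t (fun s => s) b, cfc_id' ℝ b,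
      map_one, Complex.coe_smul]
  refine ⟨cfc (fun s : ℝ => (1 + t * s)⁻¹) b, cfc_predicate _ _, ?_, ?_, ?_⟩
  · rw [← h1, ← cfc_mul _ _ b hc (by fun_prop), ← cfc_one ℝ b]
    exact cfc_congr fun s hs => inv_mul_cancel₀ (hne s hs)
  · rw [← h1, ← cfc_mul _ _ b (by fun_prop) hc, ← cfc_one ℝ b]
    exact cfc_congr fun s hs => mul_inv_cancel₀ (hne s hs)
  · have h2 : (2 : ℂ) • cfc (fun s : ℝ => (1 + t * s)⁻¹) b - 1 =
        cfc (fun s : ℝ => 2 * (1 + t * s)⁻¹ - 1) b := by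
      rw [cfc_sub (fun s : ℝ => 2 * (1 + t * s)⁻¹) (fun _ => 1) b (hc.const_mul 2) (by fun_prop),
        cfc_const_mul (2 : ℝ) _ b hc, cfc_const_one ℝ b]
      congr 1
    rw [h2]
    refine norm_cfc_le zero_le_one fun s hs => ?_
    have h3 : 0 ≤ t * s := mul_nonneg ht (hspec s hs)
    have h4 : (1 + t * s)⁻¹ ≤ 1 := inv_le_one_of_one_le₀ (by linarith)
    have h5 : 0 ≤ (1 + t * s)⁻¹ := by positivity
    rw [Real.norm_eq_abs, abs_le]
    constructor <;> linarith

/-- Vector forms are orthogonal if the corresponding form on the commutant vanishes. -/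
theorem orthogonal_vectorForm (π : M →⋆ₐ[ℂ] (H →L[ℂ] H)) {φ χ : H}
    (h : ∀ z : commutant π, inner ℂ φ ((z : H →L[ℂ] H) χ) = 0) :
    Orthogonal (vectorForm π χ) (vectorForm π φ) := by
  refine le_antisymm (norm_sub_le _ _) ?_
  rw [norm_vectorForm, norm_vectorForm]
  set f := vectorForm π χ - vectorForm π φ with hf
  -- Let `y` separate the vectors up to `r²` and let `d = (1 + r⁻²yy*)⁻¹`. Then `⟨φ, dφ⟩` is of
  -- order `r` and `⟨χ, dχ⟩` differs from `‖χ‖²` by at most `r²`, so the contraction `2d - 1` nearly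
  -- realizes `‖χ‖² + ‖φ‖²`.
  have key : ∀ r : ℝ, 0 < r → r ≤ 1 →
      ‖χ‖ ^ 2 + ‖φ‖ ^ 2 ≤ ‖f‖ + (2 + 2 * ‖φ‖ + 2 * ‖φ‖ ^ 2) * r := by
    intro r hr hr1
    obtain ⟨y, hyφ, hyχ⟩ := exists_approximate_separation π h (pow_pos hr 2)
    set t : ℝ := (r ^ 2)⁻¹ with ht
    have ht0 : 0 < t := by positivity
    obtain ⟨d, hd, hd1, hd2, hdn⟩ := exists_resolvent y ht0.le
    have hds : star d = d := hd
    have quad : ∀ ξ : H, (inner ℂ ξ (π d ξ) : ℂ).re =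
        ‖π d ξ‖ ^ 2 + t * ‖π (star y) (π d ξ)‖ ^ 2 := by
      intro ξ
      have e1 : π d ξ = π (d * (1 + (t : ℂ) • (y * star y)) * d) ξ := by rw [hd1, one_mul]
      have e2 : inner ℂ ξ (π d ξ) = inner ℂ (π d ξ) (π d ξ) +
          t * inner ℂ (π (star y) (π d ξ)) (π (star y) (π d ξ)) := by
        conv_lhs => rw [e1]
        rw [inner_rep_left π (star y), star_star, mul_assoc, map_mul, mul_apply_eq_comp,
          inner_rep_right, hds]
        simp [-Complex.coe_smul, add_mul]
      have e5 : ∀ ζ : H, (inner ℂ ζ ζ : ℂ).re = ‖ζ‖ ^ 2 := fun ζ => inner_self_eq_norm_sq (𝕜 := ℂ) ζ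
      rw [e2, Complex.add_re, Complex.re_ofReal_mul, e5, e5]
    have qφ := quad φ
    have nn : (inner ℂ φ (π d φ) : ℂ).re ≤ ‖φ‖ * ‖π d φ‖ := re_inner_le_norm (𝕜 := ℂ) φ (π d φ)
    have tpos : 0 ≤ t * ‖π (star y) (π d φ)‖ ^ 2 := by positivity
    have dφ : ‖π d φ‖ ≤ ‖φ‖ := by
      by_contra hlt
      push Not at hlt
      nlinarith [norm_nonneg φ]
    have ydφ : ‖π (star y) (π d φ)‖ ≤ r * ‖φ‖ := by
      have h1 : t * ‖π (star y) (π d φ)‖ ^ 2 ≤ ‖φ‖ ^ 2 := by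
        nlinarith [norm_nonneg φ, norm_nonneg (π d φ)]
      rw [ht, inv_mul_le_iff₀ (by positivity), ← mul_pow] at h1
      exact abs_le_of_sq_le_sq' h1 (by positivity) |>.2
    have boundφ : (inner ℂ φ (π d φ) : ℂ).re ≤ r ^ 2 * ‖φ‖ + r * ‖φ‖ ^ 2 := by
      have e1 : inner ℂ φ (π d φ) =
          inner ℂ (φ - π y φ) (π d φ) + inner ℂ φ (π (star y) (π d φ)) := by
        rw [inner_sub_left, inner_rep_left]
        ring
      rw [e1, Complex.add_re]
      refine add_le_add ?_ ?_
      · refine (re_inner_le_norm (𝕜 := ℂ) _ _).trans (mul_le_mul ?_ dφ (norm_nonneg _) (by positivity))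
        rwa [norm_sub_rev]
      · refine (re_inner_le_norm (𝕜 := ℂ) _ _).trans ?_
        nlinarith [norm_nonneg φ]
    have boundχ : ‖χ‖ ^ 2 - (inner ℂ χ (π d χ) : ℂ).re ≤ r ^ 2 := by
      have e0 : d * (y * star y) * (t : ℂ) • (1 : M) = 1 - d := by
        rw [mul_smul_comm, mul_one, ← mul_smul_comm]
        rw [mul_add, mul_one] at hd1
        exact eq_sub_of_add_eq' hd1
      have e0' : (t : ℂ) • (y * star y * d) = 1 - d := by
        rw [add_mul, one_mul, smul_mul_assoc] at hd2
        exact eq_sub_of_add_eq' hd2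
      -- With `b = yy*` this is `1 - d = tb - t²bdb`. The last term is positive, so `1 - d` is
      -- controlled by `t‖y*χ‖²`.
      have e1 : (1 : M) - d = (t : ℂ) • (y * star y) -
          (t : ℂ) • (t : ℂ) • ((y * star y) * d * (y * star y)) := by
        have e2 : (t : ℂ) • ((t : ℂ) • (y * star y * d)) * (y * star y) =
          (t : ℂ) • ((1 - d) * (y * star y)) := by rw [e0', smul_mul_assoc]
        have e3 : (t : ℂ) • (d * (y * star y)) = 1 - d := by
          rw [← e0, mul_smul_comm, mul_one]
        rw [sub_mul, one_mul, smul_sub, e3] at e2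
        rw [smul_mul_assoc, smul_mul_assoc] at e2
        rw [e2]
        abel
      have e2 : inner ℂ χ χ - inner ℂ χ (π d χ) = t * inner ℂ (π (star y) χ) (π (star y) χ) -
          t * (t * inner ℂ (π (y * star y) χ) (π d (π (y * star y) χ))) := by
        have e3 : inner ℂ χ (π (1 - d) χ) = inner ℂ χ χ - inner ℂ χ (π d χ) := by
          simp
        rw [← e3, e1, inner_rep_left π (star y), star_star, inner_rep_left π (y * star y)]
        simp [-Complex.coe_smul]
      have e3 := congrArg Complex.re e2
      have e4 : 0 ≤ (inner ℂ (π (y * star y) χ) (π d (π (y * star y) χ)) : ℂ).re := by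
        rw [quad]
        positivity
      rw [Complex.sub_re, Complex.sub_re, Complex.re_ofReal_mul, Complex.re_ofReal_mul,
        Complex.re_ofReal_mul] at e3
      have e5 : ∀ ξ : H, (inner ℂ ξ ξ : ℂ).re = ‖ξ‖ ^ 2 := fun ξ => inner_self_eq_norm_sq (𝕜 := ℂ) ξ
      rw [e5, e5] at e3
      rw [e3]
      have e6 : t * ‖π (star y) χ‖ ^ 2 ≤ r ^ 2 := by
        rw [ht, inv_mul_le_iff₀ (by positivity)]
        have := pow_le_pow_left₀ (norm_nonneg _) hyχ 2
        nlinarith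
      have e7 : 0 ≤ t * (t * (inner ℂ (π (y * star y) χ) (π d (π (y * star y) χ)) : ℂ).re) := by
        positivity
      linarith
    have hfle : (f ((2 : ℂ) • d - 1)).re ≤ ‖f‖ := by
      refine (Complex.re_le_norm _).trans ((f.le_opNorm _).trans ?_)
      exact mul_le_of_le_one_right (norm_nonneg _) hdn
    have hfe : (f ((2 : ℂ) • d - 1)).re = 2 * (inner ℂ χ (π d χ) : ℂ).re - ‖χ‖ ^ 2 -
        (2 * (inner ℂ φ (π d φ) : ℂ).re - ‖φ‖ ^ 2) := by
      have e5 : ∀ ξ : H, (inner ℂ ξ ξ : ℂ).re = ‖ξ‖ ^ 2 := fun ξ => inner_self_eq_norm_sq (𝕜 := ℂ) ξ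
      rw [← e5 χ, ← e5 φ, hf]
      simp [vectorForm_apply]
    nlinarith [norm_nonneg φ, mul_nonneg (norm_nonneg φ) hr.le]
  set C := 2 + 2 * ‖φ‖ + 2 * ‖φ‖ ^ 2
  have hC : 0 < C := by positivity
  refine le_of_forall_pos_le_add fun ε hε => ?_
  have h1 := key (min 1 (ε / C)) (by positivity) (min_le_left _ _)
  have h2 : C * min 1 (ε / C) ≤ ε := by
    have := mul_le_mul_of_nonneg_left (min_le_right 1 (ε / C)) hC.le
    rwa [mul_div_cancel₀ _ hC.ne'] at this
  linarith

end Orthogonality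

/-! ### The form `ϱ^⊥` and the bound on transition amplitudes -/

section PerpPart

variable {M : Type u} [CStarAlgebra M]
variable {H : Type v} [NormedAddCommGroup H] [InnerProductSpace ℂ H] [CompleteSpace H]

theorem norm_rep_eq_of_mem_fibre {K : Type*} [NormedAddCommGroup K] [InnerProductSpace ℂ K]
    [CompleteSpace K] {π : M →⋆ₐ[ℂ] (H →L[ℂ] H)} {π' : M →⋆ₐ[ℂ] (K →L[ℂ] K)} {μ : M →L[ℂ] ℂ}
    {χ : H} {χ' : K} (h : χ ∈ fibre π μ) (h' : χ' ∈ fibre π' μ) (x : M) :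
    ‖π x χ‖ = ‖π' x χ'‖ := by
  have h1 := ((mem_fibre_iff π μ χ).1 h x).symm.trans ((mem_fibre_iff π' μ χ').1 h' x)
  norm_cast at h1
  exact (pow_left_inj₀ (norm_nonneg _) (norm_nonneg _) two_ne_zero).1 h1

theorem norm_eq_of_mem_fibre {K : Type*} [NormedAddCommGroup K] [InnerProductSpace ℂ K]
    [CompleteSpace K] {π : M →⋆ₐ[ℂ] (H →L[ℂ] H)} {π' : M →⋆ₐ[ℂ] (K →L[ℂ] K)} {μ : M →L[ℂ] ℂ}
    {χ : H} {χ' : K} (h : χ ∈ fibre π μ) (h' : χ' ∈ fibre π' μ) : ‖χ‖ = ‖χ'‖ := by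
  simpa using norm_rep_eq_of_mem_fibre h h' 1

theorem isPositiveForm_vectorForm (π : M →⋆ₐ[ℂ] (H →L[ℂ] H)) (χ : H) :
    IsPositiveForm (vectorForm π χ) := fun x => by
  rw [vectorForm_star_mul_self]
  exact_mod_cast sq_nonneg ‖π x χ‖

theorem formLE_vectorForm_iff {K : Type*} [NormedAddCommGroup K] [InnerProductSpace ℂ K]
    [CompleteSpace K] (π : M →⋆ₐ[ℂ] (H →L[ℂ] H)) (π' : M →⋆ₐ[ℂ] (K →L[ℂ] K)) (χ : H) (χ' : K) :
    FormLE (vectorForm π χ) (vectorForm π' χ') ↔ ∀ x, ‖π x χ‖ ≤ ‖π' x χ'‖ := by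
  refine forall_congr' fun x => ?_
  rw [sub_apply, vectorForm_star_mul_self, vectorForm_star_mul_self, sub_nonneg]
  norm_cast
  exact sq_le_sq₀ (norm_nonneg _) (norm_nonneg _)

theorem adjoint_intertwiner {K : Type*} [NormedAddCommGroup K] [InnerProductSpace ℂ K]
    [CompleteSpace K] {π : M →⋆ₐ[ℂ] (H →L[ℂ] H)} {π' : M →⋆ₐ[ℂ] (K →L[ℂ] K)} {A : H →L[ℂ] K}
    (hA : ∀ x ξ, A (π x ξ) = π' x (A ξ)) (x : M) (η : K) :
    ContinuousLinearMap.adjoint A (π' x η) = π x (ContinuousLinearMap.adjoint A η) := by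
  refine ext_inner_left ℂ fun ξ => ?_
  rw [ContinuousLinearMap.adjoint_inner_right, inner_rep_right, ← hA,
    ← ContinuousLinearMap.adjoint_inner_right, ← inner_rep_right]

theorem inner_star_apply (z : H →L[ℂ] H) (ξ η : H) : inner ℂ (star z ξ) η = inner ℂ ξ (z η) := by
  rw [ContinuousLinearMap.star_eq_adjoint, ContinuousLinearMap.adjoint_inner_left]

theorem IsLargestOrthogonalBelow.unique {ν ϱ σ τ : M →L[ℂ] ℂ}
    (hσ : IsLargestOrthogonalBelow ν ϱ σ) (hτ : IsLargestOrthogonalBelow ν ϱ τ) : σ = τ := by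
  have h1 := hσ.2 τ hτ.1.1 hτ.1.2.1 hτ.1.2.2
  have h2 := hτ.2 σ hσ.1.1 hσ.1.2.1 hσ.1.2.2
  have h3 : (σ : M →ₗ[ℂ] ℂ) = τ := functional_ext_of_star_mul_self fun x =>
    le_antisymm (sub_nonneg.1 (h2 x)) (sub_nonneg.1 (h1 x))
  ext x
  exact LinearMap.congr_fun h3 x

namespace IsPolarDecomposition

variable {π : M →⋆ₐ[ℂ] (H →L[ℂ] H)} {ψ φ : H} {g : commutant π →ₗ[ℂ] ℂ} {v : commutant π}

theorem norm_sq_split {h : commutant π →ₗ[ℂ] ℂ} (hp : IsPolarDecomposition (commutant π) h g v)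
    (ξ : H) : ‖(star v : H →L[ℂ] H) ξ‖ ^ 2 + ‖((1 - v * star v : commutant π) : H →L[ℂ] H) ξ‖ ^ 2 =
      ‖ξ‖ ^ 2 := by
  have h1 : star (v : H →L[ℂ] H) ((v : H →L[ℂ] H) (star (v : H →L[ℂ] H) ξ)) =
      star (v : H →L[ℂ] H) ξ :=
    DFunLike.congr_fun (congrArg Subtype.val hp.initial_mul_star) ξ
  have e1 : ((1 - v * star v : commutant π) : H →L[ℂ] H) ξ =
      ξ - (v : H →L[ℂ] H) (star (v : H →L[ℂ] H) ξ) := by simp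
  have h2 : ‖(v : H →L[ℂ] H) (star (v : H →L[ℂ] H) ξ)‖ ^ 2 = ‖star (v : H →L[ℂ] H) ξ‖ ^ 2 := by
    have h3 : inner ℂ ((v : H →L[ℂ] H) (star (v : H →L[ℂ] H) ξ))
        ((v : H →L[ℂ] H) (star (v : H →L[ℂ] H) ξ)) =
        inner ℂ (star (v : H →L[ℂ] H) ξ) (star (v : H →L[ℂ] H) ξ) := by
      rw [← inner_star_apply, h1]
    rw [inner_self_eq_norm_sq_to_K, inner_self_eq_norm_sq_to_K] at h3
    exact_mod_cast h3
  have h5 : (inner ℂ ξ ((v : H →L[ℂ] H) (star (v : H →L[ℂ] H) ξ)) : ℂ).re =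
      ‖star (v : H →L[ℂ] H) ξ‖ ^ 2 := by
    rw [← inner_star_apply]
    exact inner_self_eq_norm_sq (𝕜 := ℂ) _
  have h6 := norm_sub_sq (𝕜 := ℂ) ξ ((v : H →L[ℂ] H) (star (v : H →L[ℂ] H) ξ))
  change _ = _ - 2 * (inner ℂ ξ ((v : H →L[ℂ] H) (star (v : H →L[ℂ] H) ξ)) : ℂ).re + _ at h6
  rw [e1, h6, h5, h2]
  change ‖star (v : H →L[ℂ] H) ξ‖ ^ 2 + _ = _
  ring

theorem defect_mul_phase {h : commutant π →ₗ[ℂ] ℂ}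
    (hp : IsPolarDecomposition (commutant π) h g v) : (1 - v * star v) * v = 0 := by
  rw [sub_mul, one_mul, mul_assoc, hp.mul_initial, sub_self]

theorem map_mul_defect {h : commutant π →ₗ[ℂ] ℂ} (hp : IsPolarDecomposition (commutant π) h g v)
    (z : commutant π) : h (z * (1 - v * star v)) = 0 := by
  rw [hp.factor, mul_assoc, hp.defect_mul_phase, mul_zero, map_zero]

/-- The vector form of `(1 - vv*)ψ` is the largest form below that of `ψ` which is orthogonal to that
of `φ`. -/
theorem isLargestOrthogonalBelow
    (hp : IsPolarDecomposition (commutant π) (transitionForm π ψ φ) g v) :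
    IsLargestOrthogonalBelow (vectorForm π φ) (vectorForm π ψ)
      (vectorForm π (((1 - v * star v : commutant π) : H →L[ℂ] H) ψ)) := by
  set e : commutant π := 1 - v * star v with he
  have hele : ∀ ξ, ‖(e : H →L[ℂ] H) ξ‖ ≤ ‖ξ‖ := fun ξ =>
    abs_le_of_sq_le_sq' (by linarith [hp.norm_sq_split ξ, sq_nonneg ‖(star v : H →L[ℂ] H) ξ‖])
      (norm_nonneg _) |>.2
  refine ⟨⟨isPositiveForm_vectorForm _ _, ?_, ?_⟩, ?_⟩
  · exact orthogonal_vectorForm π fun z => hp.map_mul_defect z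
  · rw [formLE_vectorForm_iff]
    intro x
    rw [← commutant_apply]
    exact hele _
  · intro τ hτ hτo hτle
    obtain ⟨K, _, _, _, π', ξ, hξ⟩ := exists_rep_of_isPositiveForm τ hτ
    rw [eq_vectorForm hξ] at hτo hτle ⊢
    rw [formLE_vectorForm_iff] at hτle
    obtain ⟨A, hAn, hAψ, hA⟩ := exists_intertwiner π π' ψ ξ hτle
    have hA' := adjoint_intertwiner hA
    -- Orthogonality of `τ` to the form of `φ` gives `h(zA*A) = 0` for all `z`, hence `A*Av = 0` and
    -- `Av = 0`. So `A = Ae`, and `τ` is the form of `Aeψ` with `A` a contraction.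
    let T : commutant π := ⟨ContinuousLinearMap.adjoint A ∘L A,
      mem_commutant_of_apply fun x η => by
        rw [ContinuousLinearMap.comp_apply, ContinuousLinearMap.comp_apply, hA, hA']⟩
    have hT : T * v = 0 := by
      refine hp.mul_phase_eq_zero fun z => ?_
      have h1 := inner_intertwiner_eq_zero π π' hτo
        (B := (z : H →L[ℂ] H) ∘L ContinuousLinearMap.adjoint A) fun x η => by
          rw [ContinuousLinearMap.comp_apply, ContinuousLinearMap.comp_apply, hA', commutant_apply]
      rw [← hAψ] at h1
      exact h1
    have hAv : ∀ η, A ((v : H →L[ℂ] H) η) = 0 := by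
      intro η
      have h1 : ContinuousLinearMap.adjoint A (A ((v : H →L[ℂ] H) η)) = 0 :=
        DFunLike.congr_fun (congrArg Subtype.val hT) η
      rw [← inner_self_eq_zero (𝕜 := ℂ), ← ContinuousLinearMap.adjoint_inner_left, h1,
        inner_zero_left]
    have hAe : ∀ η, A ((e : H →L[ℂ] H) η) = A η := by
      intro η
      have h1 : (e : H →L[ℂ] H) η = η - (v : H →L[ℂ] H) (star (v : H →L[ℂ] H) η) := by simp [he]
      rw [h1, map_sub, hAv, sub_zero]
    rw [formLE_vectorForm_iff]
    intro x
    rw [← hAψ, ← hA, ← hAe, commutant_apply]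
    simpa using A.le_of_opNorm_le hAn (π x ((e : H →L[ℂ] H) ψ))

theorem perpPart_eq (hp : IsPolarDecomposition (commutant π) (transitionForm π ψ φ) g v)
    {ν ϱ : M →L[ℂ] ℂ} (hφ : φ ∈ fibre π ν) (hψ : ψ ∈ fibre π ϱ) :
    perpPart ν ϱ = vectorForm π (((1 - v * star v : commutant π) : H →L[ℂ] H) ψ) := by
  have h := hp.isLargestOrthogonalBelow
  rw [← eq_vectorForm hφ, ← eq_vectorForm hψ] at h
  have hex : ∃ σ, IsLargestOrthogonalBelow ν ϱ σ := ⟨_, h⟩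
  rw [perpPart, dif_pos hex]
  exact hex.choose_spec.unique h

/-- Transition amplitudes do not exceed the total mass of the absolute value. -/
theorem re_inner_le (hp : IsPolarDecomposition (commutant π) (transitionForm π ψ φ) g v)
    {ν ϱ : M →L[ℂ] ℂ} (hφ : φ ∈ fibre π ν) (hψ : ψ ∈ fibre π ϱ) {K : Type*}
    [NormedAddCommGroup K] [InnerProductSpace ℂ K] [CompleteSpace K] {π' : M →⋆ₐ[ℂ] (K →L[ℂ] K)}
    {φ' ψ' : K} (hφ' : φ' ∈ fibre π' ν) (hψ' : ψ' ∈ fibre π' ϱ) :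
    (inner ℂ φ' ψ' : ℂ).re ≤ (g 1).re := by
  obtain ⟨U, hUn, hUφ, hU⟩ := exists_intertwiner π π' φ φ'
    fun x => (norm_rep_eq_of_mem_fibre hφ' hφ x).le
  obtain ⟨W, hWn, hWψ, hW⟩ := exists_intertwiner π π' ψ ψ'
    fun x => (norm_rep_eq_of_mem_fibre hψ' hψ x).le
  let z : commutant π := ⟨ContinuousLinearMap.adjoint U ∘L W,
    mem_commutant_of_apply fun x η => by
      rw [ContinuousLinearMap.comp_apply, ContinuousLinearMap.comp_apply, hW,
        adjoint_intertwiner hU]⟩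
  have hz : ‖(z : H →L[ℂ] H)‖ ≤ 1 := by
    refine (ContinuousLinearMap.opNorm_comp_le _ _).trans (mul_le_one₀ ?_ (norm_nonneg _) hWn)
    rwa [LinearIsometryEquiv.norm_map]
  have h1 : inner ℂ φ' ψ' = transitionForm π ψ φ z := by
    rw [← hUφ, ← hWψ, ← ContinuousLinearMap.adjoint_inner_right]
    rfl
  rw [h1, hp.factor]
  exact hp.re_le ((norm_mul_le _ _).trans (mul_le_one₀ hz (norm_nonneg _) hp.norm_le_one))

theorem inner_phase (hp : IsPolarDecomposition (commutant π) (transitionForm π ψ φ) g v) :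
    inner ℂ φ (star (v : H →L[ℂ] H) ψ) = g 1 := by
  rw [hp.eq_map_mul_star, one_mul]
  rfl

end IsPolarDecomposition

end PerpPart

/-! ### The Bures distance from the polar decomposition -/

section Distance

variable {M : Type u} [CStarAlgebra M]
variable {H : Type v} [NormedAddCommGroup H] [InnerProductSpace ℂ H] [CompleteSpace H]
variable {π : M →⋆ₐ[ℂ] (H →L[ℂ] H)} {ψ φ : H} {g : commutant π →ₗ[ℂ] ℂ} {v : commutant π}

omit [CompleteSpace H] in
theorem norm_sub_sq_re (φ ψ : H) :
    ‖ψ - φ‖ ^ 2 = ‖ψ‖ ^ 2 + ‖φ‖ ^ 2 - 2 * (inner ℂ φ ψ : ℂ).re := by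
  have h := norm_sub_sq (𝕜 := ℂ) ψ φ
  rw [inner_re_symm] at h
  change _ = _ - 2 * (inner ℂ φ ψ : ℂ).re + _ at h
  linarith

/-- The Bures distance in terms of the polar decomposition. -/
theorem buresDist_sq (hp : IsPolarDecomposition (commutant π) (transitionForm π ψ φ) g v)
    {ν ϱ : M →L[ℂ] ℂ} (hφ : φ ∈ fibre π ν) (hψ : ψ ∈ fibre π ϱ) :
    0 ≤ buresDist.{u, v} ν ϱ ∧
      buresDist.{u, v} ν ϱ ^ 2 = ‖ψ‖ ^ 2 + ‖φ‖ ^ 2 - 2 * (g 1).re := by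
  set e : commutant π := 1 - v * star v with he
  -- A two-element index type in universe `u`, so that the direct sum lives in `Type (max u v)`, as
  -- the definition of the distance demands.
  let ι := Option PUnit.{u + 1}
  let pair : H → H → PiLp 2 (fun _ : ι => H) := fun a b => WithLp.toLp 2 fun i => i.elim a fun _ => b
  have hnorm : ∀ a b, ‖pair a b‖ ^ 2 = ‖a‖ ^ 2 + ‖b‖ ^ 2 := fun a b => by
    rw [PiLp.norm_sq_eq_of_L2, Fintype.sum_option]
    simp [pair]
  have hpair : ∀ x a b, diagRep ι π x (pair a b) = pair (π x a) (π x b) := fun x a b => by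
    ext i
    rcases i with _ | i <;> rfl
  have hΦ : pair φ 0 ∈ fibre (diagRep ι π) ν := by
    rw [mem_fibre_iff] at hφ ⊢
    intro x
    rw [hφ, hpair, ← Complex.ofReal_pow, ← Complex.ofReal_pow, hnorm]
    simp
  have hΨ : pair (star (v : H →L[ℂ] H) ψ) ((e : H →L[ℂ] H) ψ) ∈ fibre (diagRep ι π) ϱ := by
    rw [mem_fibre_iff] at hψ ⊢
    intro x
    have h1 : π x (star (v : H →L[ℂ] H) ψ) = star (v : H →L[ℂ] H) (π x ψ) :=
      (commutant_apply (star v) x ψ).symm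
    rw [hψ, hpair, ← Complex.ofReal_pow, ← Complex.ofReal_pow, hnorm, ← commutant_apply e, h1,
      ← hp.norm_sq_split (π x ψ)]
  have hinner : inner ℂ (pair φ 0) (pair (star (v : H →L[ℂ] H) ψ) ((e : H →L[ℂ] H) ψ)) = g 1 := by
    rw [PiLp.inner_apply, Fintype.sum_option, ← hp.inner_phase]
    simp [pair]
  have hlow : ∀ r ∈ fibreDistances.{u, v} ν ϱ, 0 ≤ r ∧
      ‖ψ‖ ^ 2 + ‖φ‖ ^ 2 - 2 * (g 1).re ≤ r ^ 2 := by
    rintro _ ⟨K, _, _, _, π', φ', hφ', ψ', hψ', rfl⟩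
    refine ⟨norm_nonneg _, ?_⟩
    rw [norm_sub_sq_re, norm_eq_of_mem_fibre hφ' hφ, norm_eq_of_mem_fibre hψ' hψ]
    linarith [hp.re_inner_le hφ hψ hφ' hψ']
  have hval : ‖pair (star (v : H →L[ℂ] H) ψ) ((e : H →L[ℂ] H) ψ) - pair φ 0‖ ^ 2 =
      ‖ψ‖ ^ 2 + ‖φ‖ ^ 2 - 2 * (g 1).re := by
    rw [norm_sub_sq_re, hinner, norm_eq_of_mem_fibre hΦ hφ, norm_eq_of_mem_fibre hΨ hψ]
  have heq : buresDist.{u, v} ν ϱ =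
      ‖pair (star (v : H →L[ℂ] H) ψ) ((e : H →L[ℂ] H) ψ) - pair φ 0‖ := by
    refine IsLeast.csInf_eq ⟨⟨_, inferInstance, inferInstance, inferInstance, diagRep ι π, _, hΦ, _,
      hΨ, rfl⟩, fun r hr => ?_⟩
    obtain ⟨h0, h1⟩ := hlow r hr
    rw [← hval] at h1
    exact abs_le_of_sq_le_sq' h1 h0 |>.2
  rw [heq]
  exact ⟨norm_nonneg _, hval⟩

/-- Norms are constant on fibres, so only the real part of the inner product decides. -/
theorem buresDist_eq_norm_iff (hp : IsPolarDecomposition (commutant π) (transitionForm π ψ φ) g v)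
    {ν ϱ : M →L[ℂ] ℂ} (hφ : φ ∈ fibre π ν) (hψ : ψ ∈ fibre π ϱ) {χ : H} (hχ : χ ∈ fibre π ϱ) :
    buresDist.{u, v} ν ϱ = ‖χ - φ‖ ↔ (inner ℂ φ χ : ℂ).re = (g 1).re := by
  obtain ⟨h0, h1⟩ := buresDist_sq hp hφ hψ
  rw [← pow_left_inj₀ h0 (norm_nonneg _) two_ne_zero, h1, norm_sub_sq_re,
    norm_eq_of_mem_fibre hχ hψ]
  constructor <;> intro h <;> linarith

end Distance

/-! ### Condition `(*)` and the construction of attaining vectors -/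

section MinimalPairs

variable {M : Type u} [CStarAlgebra M]
variable {H : Type v} [NormedAddCommGroup H] [InnerProductSpace ℂ H] [CompleteSpace H]
variable {π : M →⋆ₐ[ℂ] (H →L[ℂ] H)} {ψ φ : H} {g : commutant π →ₗ[ℂ] ℂ} {v : commutant π}

/-- Reduces `(*)` to one vector equation: `s` lies in the commutant, so its kernel is closed and
invariant and contains the cyclic subspace of `η` once it contains `η`. -/
theorem cyclicProj_le_iff (π : M →⋆ₐ[ℂ] (H →L[ℂ] H)) (η : H) {s : commutant π}
    (hs : IsStarProjection (s : H →L[ℂ] H)) :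
    cyclicProj π η ≤ 1 - (s : H →L[ℂ] H) ↔ (s : H →L[ℂ] H) η = 0 := by
  have hcp : IsStarProjection (cyclicProj π η) := isStarProjection_starProjection
  constructor
  · intro h
    have hη : cyclicProj π η η = η := Submodule.starProjection_eq_self_iff.2
      (Submodule.le_topologicalClosure _ (Submodule.subset_span ⟨1, by simp⟩))
    have h1 := ((ContinuousLinearMap.le_def _ _).1 h).re_inner_nonneg_right η
    have h2 : inner ℂ η ((s : H →L[ℂ] H) η) =
        inner ℂ ((s : H →L[ℂ] H) η) ((s : H →L[ℂ] H) η) := by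
      have h3 : star (s : H →L[ℂ] H) = s := hs.isSelfAdjoint
      have h4 : (s : H →L[ℂ] H) ((s : H →L[ℂ] H) η) = (s : H →L[ℂ] H) η :=
        DFunLike.congr_fun hs.isIdempotentElem η
      rw [← inner_star_apply, h3, ← inner_star_apply, h3, h4]
    rw [sub_apply, sub_apply, hη, one_apply_eq_self, sub_sub_cancel_left, inner_neg_right, h2,
      map_neg, inner_self_eq_norm_sq] at h1
    have h5 : ‖(s : H →L[ℂ] H) η‖ ^ 2 = 0 := le_antisymm (by linarith) (sq_nonneg _)
    exact norm_eq_zero.1 (pow_eq_zero_iff two_ne_zero |>.1 h5)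
  · intro h
    have hker : ∀ ξ, (s : H →L[ℂ] H) (cyclicProj π η ξ) = 0 := by
      intro ξ
      have h1 : (Submodule.span ℂ (Set.range fun x : M => π x η)).topologicalClosure ≤
          LinearMap.ker (s : H →L[ℂ] H).toLinearMap := by
        refine Submodule.topologicalClosure_minimal _ (Submodule.span_le.2 ?_)
          (s : H →L[ℂ] H).isClosed_ker
        rintro _ ⟨x, rfl⟩
        change (s : H →L[ℂ] H) (π x η) = 0
        rw [commutant_apply, h, map_zero]
      exact h1 (Submodule.starProjection_apply_mem _ ξ)
    have hmul : (s : H →L[ℂ] H) * cyclicProj π η = 0 := ContinuousLinearMap.ext hker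
    have h2 := (hs.add hcp hmul).one_sub.nonneg
    rw [← sub_nonneg, sub_sub]
    exact h2

theorem IsPolarDecomposition.isStarProjection_initial {h : commutant π →ₗ[ℂ] ℂ}
    (hp : IsPolarDecomposition (commutant π) h g v) :
    IsStarProjection ((star v * v : commutant π) : H →L[ℂ] H) := by
  rw [hp.initial]
  exact support_isStarProjection _ _

/-- The polar decomposition of `h_{wψ, φ}` for `w` in the commutant with `w*wψ = ψ`. -/
theorem IsPolarDecomposition.transport
    (hp : IsPolarDecomposition (commutant π) (transitionForm π ψ φ) g v) {w : commutant π}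
    (hw : star (w : H →L[ℂ] H) ((w : H →L[ℂ] H) ψ) = ψ) :
    IsPolarDecomposition (commutant π) (transitionForm π ((w : H →L[ℂ] H) ψ) φ) g (w * v) := by
  -- The element `1 - w*w` kills `ψ`, hence `h` vanishes on its left multiples.
  have h1 : (1 - star w * w) * v = 0 := by
    refine hp.mul_phase_eq_zero fun z => ?_
    have h2 : ((z * (1 - star w * w) : commutant π) : H →L[ℂ] H) ψ = 0 := by
      simp [hw]
    rw [transitionForm_apply, h2, inner_zero_right]
  rw [sub_mul, one_mul, sub_eq_zero] at h1
  refine ⟨hp.normal, hp.nonneg, ?_, fun z => ?_⟩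
  · have h2 : star (w * v) * (w * v) = star v * v := by
      rw [star_mul, mul_assoc, ← mul_assoc (star w) w v, ← h1]
    rw [h2, hp.initial]
  · rw [← mul_assoc, ← hp.factor]
    rfl

/-- As `v*` has range in that of `s` and `sη = 0`, the two orbits are orthogonal termwise.
Pythagoras and the splitting of `‖π(x)ψ‖²` by `v*` and `1 - vv*` give the fibre; orthogonality of
`ϱ^⊥` and `ν` removes `η` from the inner product. -/
theorem IsPolarDecomposition.add_phase_mem_fibre
    (hp : IsPolarDecomposition (commutant π) (transitionForm π ψ φ) g v)
    {ν ϱ : M →L[ℂ] ℂ} (hφ : φ ∈ fibre π ν) (hψ : ψ ∈ fibre π ϱ) {η : H}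
    (hη : η ∈ fibre π (perpPart ν ϱ)) (hsη : ((star v * v : commutant π) : H →L[ℂ] H) η = 0) :
    star (v : H →L[ℂ] H) ψ + η ∈ fibre π ϱ ∧
      (inner ℂ φ (star (v : H →L[ℂ] H) ψ + η) : ℂ).re = (g 1).re := by
  rw [hp.perpPart_eq hφ hψ] at hη
  have hψ' := (mem_fibre_iff π ϱ ψ).1 hψ
  constructor
  · rw [mem_fibre_iff]
    intro x
    have hcross : inner ℂ (star (v : H →L[ℂ] H) (π x ψ)) (π x η) = 0 := by
      have h1 : ((star v * v : commutant π) : H →L[ℂ] H) (star (v : H →L[ℂ] H) (π x ψ)) =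
          star (v : H →L[ℂ] H) (π x ψ) :=
        DFunLike.congr_fun (congrArg Subtype.val hp.initial_mul_star) (π x ψ)
      have h2 : star ((star v * v : commutant π) : H →L[ℂ] H) =
          ((star v * v : commutant π) : H →L[ℂ] H) := hp.isStarProjection_initial.isSelfAdjoint
      rw [← h1, ← h2, inner_star_apply, commutant_apply, hsη, map_zero, inner_zero_right]
    have h3 : π x (star (v : H →L[ℂ] H) ψ) = star (v : H →L[ℂ] H) (π x ψ) :=
      (commutant_apply (star v) x ψ).symm
    have h4 : ‖π x η‖ = ‖((1 - v * star v : commutant π) : H →L[ℂ] H) (π x ψ)‖ := by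
      rw [commutant_apply]
      exact norm_rep_eq_of_mem_fibre hη (mem_fibre_vectorForm π _) x
    have h5 : ‖star (v : H →L[ℂ] H) (π x ψ) + π x η‖ ^ 2 = ‖π x ψ‖ ^ 2 := by
      have h6 := norm_add_sq_eq_norm_sq_add_norm_sq_of_inner_eq_zero
        (𝕜 := ℂ) (star (v : H →L[ℂ] H) (π x ψ)) (π x η) hcross
      rw [← hp.norm_sq_split (π x ψ), ← h4, sq, h6, sq, sq]
    rw [hψ', map_add, h3, ← Complex.ofReal_pow, ← Complex.ofReal_pow, h5]
  · have horth : inner ℂ φ η = 0 := by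
      have h1 := hp.isLargestOrthogonalBelow.1.2.1
      rw [eq_vectorForm hη] at h1
      exact inner_intertwiner_eq_zero π π h1 (B := ContinuousLinearMap.id ℂ H) fun _ _ => rfl
    rw [inner_add_right, horth, add_zero, hp.inner_phase]

end MinimalPairs

end BuresFibre

end

/-! ### The theorem -/

theorem theorem2p3 {M : Type u} [CStarAlgebra M]
    {H : Type v} [NormedAddCommGroup H] [InnerProductSpace ℂ H] [CompleteSpace H]
    (π : M →⋆ₐ[ℂ] (H →L[ℂ] H)) (ν ϱ : M →L[ℂ] ℂ)
    (hν : BuresFibre.IsPositiveForm ν) (hϱ : BuresFibre.IsPositiveForm ϱ)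
    (hfν : (BuresFibre.fibre π ν).Nonempty) (hfϱ : (BuresFibre.fibre π ϱ).Nonempty)
    (φ₀ : H) (hφ₀ : φ₀ ∈ BuresFibre.fibre π ν) :
    (φ₀ ∈ BuresFibre.attainingFibre π ν ϱ ↔
      ∃ η ∈ BuresFibre.fibre π (BuresFibre.perpPart ν ϱ), ∃ ψ ∈ BuresFibre.fibre π ϱ,
        BuresFibre.cyclicProj π η ≤ 1 - BuresFibre.absSupport π ψ φ₀) ∧
    (∀ η ∈ BuresFibre.fibre π (BuresFibre.perpPart ν ϱ), ∀ ψ ∈ BuresFibre.fibre π ϱ,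
      BuresFibre.cyclicProj π η ≤ 1 - BuresFibre.absSupport π ψ φ₀ →
        (star (BuresFibre.transitionPhase π ψ φ₀) ψ + η ∈ BuresFibre.fibre π ϱ ∧
          BuresFibre.buresDist.{u, v} ν ϱ =
            ‖(star (BuresFibre.transitionPhase π ψ φ₀) ψ + η) - φ₀‖) ∧
        ∀ ψ' ∈ BuresFibre.fibre π ϱ,
          BuresFibre.cyclicProj π η ≤ 1 - BuresFibre.absSupport π ψ' φ₀ ∧
          star (BuresFibre.transitionPhase π ψ' φ₀) ψ' + η =
            star (BuresFibre.transitionPhase π ψ φ₀) ψ + η) := by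
  open BuresFibre in
  have hpol := fun ψ => isPolarDecomposition_polarPair π ψ φ₀
  have hcond : ∀ (η ψ : H), cyclicProj π η ≤ 1 - absSupport π ψ φ₀ ↔
      ((star (polarPair (commutant π) (transitionForm π ψ φ₀)).2 *
        (polarPair (commutant π) (transitionForm π ψ φ₀)).2 : commutant π) : H →L[ℂ] H) η = 0 := by
    intro η ψ
    rw [← cyclicProj_le_iff π η (hpol ψ).isStarProjection_initial, absSupport, (hpol ψ).initial]
  have hmain : ∀ η ∈ fibre π (perpPart ν ϱ), ∀ ψ ∈ fibre π ϱ,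
      cyclicProj π η ≤ 1 - absSupport π ψ φ₀ →
        star (transitionPhase π ψ φ₀) ψ + η ∈ fibre π ϱ ∧
          buresDist.{u, v} ν ϱ = ‖(star (transitionPhase π ψ φ₀) ψ + η) - φ₀‖ := by
    intro η hη ψ hψ hc
    obtain ⟨h1, h2⟩ := (hpol ψ).add_phase_mem_fibre hφ₀ hψ hη ((hcond η ψ).1 hc)
    exact ⟨h1, (buresDist_eq_norm_iff (hpol ψ) hφ₀ hψ h1).2 h2⟩
  refine ⟨⟨?_, ?_⟩, fun η hη ψ hψ hc => ⟨hmain η hη ψ hψ hc, fun ψ' hψ' => ?_⟩⟩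
  · rintro ⟨-, ψ, hψ, hd⟩
    have hp := hpol ψ
    set v := (polarPair (commutant π) (transitionForm π ψ φ₀)).2 with hv
    have h1 := (buresDist_eq_norm_iff hp hφ₀ hψ hψ).1 hd
    have h2 := hp.factor 1
    rw [one_mul] at h2
    have h3 : inner ℂ φ₀ ψ = absForm (commutant π) (transitionForm π ψ φ₀) v := h2
    rw [h3] at h1
    -- The phase itself reaches the maximum of `Re g`, so it acts as the identity on the support.
    -- Thus `v = v*v` is a projection, and `1 - vv* = 1 - s`.
    have h4 := hp.mul_initial_of_re_eq hp.norm_le_one h1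
    rw [hp.mul_initial] at h4
    have h5 : star v = v := by
      conv_lhs => rw [h4]
      rw [star_mul, star_star, ← h4]
    refine ⟨((1 - v * star v : commutant π) : H →L[ℂ] H) ψ, ?_, ψ, hψ, ?_⟩
    · rw [hp.perpPart_eq hφ₀ hψ]
      exact mem_fibre_vectorForm π _
    · rw [hcond]
      have h6 : (star v * v) * (1 - v * star v) = 0 := by
        have h7 := hp.initial_idempotent
        rw [h5] at h7 ⊢
        rw [mul_sub, mul_one, h7, sub_self]
      exact DFunLike.congr_fun (congrArg Subtype.val h6) ψ
  · rintro ⟨η, hη, ψ, hψ, hc⟩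
    obtain ⟨h1, h2⟩ := hmain η hη ψ hψ hc
    exact ⟨hφ₀, _, h1, h2⟩
  · obtain ⟨w, hwn, hwψ, hw⟩ := exists_intertwiner π π ψ ψ'
      fun x => (norm_rep_eq_of_mem_fibre hψ' hψ x).le
    let W : commutant π := ⟨w, mem_commutant_of_apply hw⟩
    -- A contraction preserving the norm of `ψ` has no defect at `ψ`.
    have hww : star w (w ψ) = ψ := by
      have h1 := contraction_add_defect_sq_le hwn ψ
      rw [hwψ, norm_eq_of_mem_fibre hψ' hψ] at h1
      have h2 : ‖ψ - star w ψ'‖ ^ 2 = 0 := le_antisymm (by linarith) (sq_nonneg _)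
      rw [hwψ]
      exact (sub_eq_zero.1 (norm_eq_zero.1 (pow_eq_zero_iff two_ne_zero |>.1 h2))).symm
    have hp' := (hpol ψ).transport (w := W) hww
    have hWψ : (W : H →L[ℂ] H) ψ = ψ' := hwψ
    rw [hWψ] at hp'
    obtain ⟨e1, e2⟩ := (hpol ψ').unique hp'
    refine ⟨?_, ?_⟩
    · rw [absSupport, e1]
      exact hc
    · rw [transitionPhase, phase, e2, transitionPhase, phase, ← hwψ]
      change star (w * _) (w ψ) + η = _
      rw [star_mul, mul_apply_eq_comp, hww]
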